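/- **Setting.** Fix $\tau\in(2,3)$ and $h_{\min}>0$. In the hidden-variable model on $n$ vertices, every vertex independently receives a hidden variable $h$ with density $\rho(h)=Ch^{-\tau}$ for $h\ge h_{\min}$ ($C$ the normalizing constant), whose mean is denoted by $\mu$. Conditionally on all hidden variables, each pair of vertices, with hidden variables $h,h'$, is joined independently with probability $\min\left(\frac{hh'}{\mu n},1\right)$. Let $H=(V_H,E_H)$ be a simple graph (a motif) on $k$ vertices. Let $N(H)$ be the number of labelled, not necessarily induced, copies of $H$ in the model, i.e. of injective maps from $V_H$ to the $n$ vertices that send edges to edges. Let $P(H)=\mathbb{E}\Big[\prod_{\{i,j\}\in E_H}\min\left(\frac{h_ih_j}{\mu n},1\right)\Big]$, with $h_1,\dots,h_k$ i.i.d. of density $\rho$, be the probability that $H$ is present on $k$ given vertices. For $\alpha\in\mathbb{R}^{V_H}$ and $\varepsilon\in(0,1)$, let $N(H,\alpha,\varepsilon)$ be the number of those copies in which, for every $i\in V_H$, the vertex playing the role of $i$ has its hidden variable in $[\varepsilon n^{\alpha_i},\varepsilon^{-1}n^{\alpha_i}]$. Put $$B_f(H)=\max\left[|S_1|-|S_2|-\frac{2E_{S_1}+E_{S_1,S_3}}{\tau-1}\right],$$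 the maximum being over all partitions of $V_H$ into three (possibly empty) classes $S_1,S_2,S_3$, where $E_{S_1}$ is the number of edges of $H$ inside $S_1$ and $E_{S_1,S_3}$ the number of edges of $H$ between $S_1$ and $S_3$. **Theorem.** Suppose that the maximum is attained by exactly one partition $(S_1,S_2,S_3)$, and put $\alpha^*_i=0$ for $i\in S_1$, $\alpha^*_i=1$ for $i\in S_2$ and $\alpha^*_i=\frac12$ for $i\in S_3$. Let $e=\frac{3-\tau}{2}k+\frac{\tau-1}{2}B_f(H)$. Call $\varepsilon\in(0,1)$ admissible if $S_1=\emptyset$ or $h_{\min}<1/\varepsilon$. Then, as $n\to\infty$: 1. $\mathbb{E}[N(H)]\sim n^kP(H)$ and $\mathbb{E}[N(H)]=\Theta(n^{e})$. 2. There are constants $c,C>0$ and a function $f$, none depending on $n$, such that for every admissible $\varepsilon$ one has $f(\varepsilon)>0$ and, for all sufficiently large $n$, $c\,f(\varepsilon)\le \mathbb{E}[N(H,\alpha^*,\varepsilon)]/n^{e}\le C\,f(\varepsilon)$. 3. For every $\alpha\ne\alpha^*$ there is $\eta>0$ such that $\mathbb{E}[N(H,\alpha,\varepsilon)]/\mathbb{E}[N(H,\alpha^*,\varepsilon)]=O(n^{-\eta})$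 for every admissible $\varepsilon$. 4. For every $\delta>0$ there is $\varepsilon_0\in(0,1)$ such that for every $\varepsilon\in(0,\varepsilon_0)$ and all sufficiently large $n$, $\mathbb{E}[N(H,\alpha^*,\varepsilon)]\ge(1-\delta)\,\mathbb{E}[N(H)]$. -/

import Mathlib

open MeasureTheory Filter Asymptotics

noncomputable section

namespace HiddenVariable

/-! ### The partition optimization problem -/

/-- Labels of the three classes of a partition of the vertices of a motif. -/
inductive Part : Type
  | S1
  | S2
  | S3

/-- A partition of the vertices of a motif on `k` vertices into classes `S₁, S₂, S₃`
(classes may be empty). -/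
abbrev VertexPartition (k : ℕ) : Type := Fin k → Part

open Classical in
/-- `|S|`: the number of vertices in the class labelled `s`. -/
def classSize {k : ℕ} (P : VertexPartition k) (s : Part) : ℕ :=
  (Finset.univ.filter fun i => P i = s).card

open Classical in
/-- `E_S`: the number of edges of `H` inside the class labelled `s`. -/
def edgesInside {k : ℕ} (H : SimpleGraph (Fin k)) (P : VertexPartition k) (s : Part) : ℕ :=
  (Finset.univ.filter fun q : Fin k × Fin k =>
    q.1 < q.2 ∧ H.Adj q.1 q.2 ∧ P q.1 = s ∧ P q.2 = s).card

open Classical in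
/-- `E_{S,T}`: the number of edges of `H` between two different classes `s` and `t`;
each such edge is listed once, with its `s`-end first. -/
def edgesBetween {k : ℕ} (H : SimpleGraph (Fin k)) (P : VertexPartition k) (s t : Part) : ℕ :=
  (Finset.univ.filter fun q : Fin k × Fin k =>
    H.Adj q.1 q.2 ∧ P q.1 = s ∧ P q.2 = t).card

/-- The objective `|S₁| - |S₂| - (2 E_{S₁} + E_{S₁,S₃}) / (τ - 1)`. -/
def objective (τ : ℝ) {k : ℕ} (H : SimpleGraph (Fin k)) (P : VertexPartition k) : ℝ :=
  (classSize P .S1 : ℝ) - (classSize P .S2 : ℝ)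
    - (2 * (edgesInside H P .S1 : ℝ) + (edgesBetween H P .S1 .S3 : ℝ)) / (τ - 1)

/-- `B_f(H)`: the maximum of the objective over the (finitely many) partitions. -/
def Bf (τ : ℝ) {k : ℕ} (H : SimpleGraph (Fin k)) : ℝ :=
  ⨆ P : VertexPartition k, objective τ H P

/-- `P` attains the maximum of the objective. -/
def IsOptimal (τ : ℝ) {k : ℕ} (H : SimpleGraph (Fin k)) (P : VertexPartition k) : Prop :=
  ∀ Q : VertexPartition k, objective τ H Q ≤ objective τ H P

/-- The exponent of a class: `0` on `S₁`, `1` on `S₂`, `1/2` on `S₃`. -/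
def Part.exponent : Part → ℝ
  | .S1 => 0
  | .S2 => 1
  | .S3 => 1 / 2

/-- The degree profile `α` attached to a partition. -/
def profile {k : ℕ} (P : VertexPartition k) : Fin k → ℝ := fun i => (P i).exponent

/-! ### The hidden-variable model -/

/-- The law of one hidden variable, with density `C h^{-τ}` on `h ≥ hmin`
(a Pareto law of shape `τ - 1`, so `C = (τ - 1) hmin^{τ - 1}`). -/
def hiddenLaw (τ hmin : ℝ) : Measure ℝ :=
  ProbabilityTheory.paretoMeasure hmin (τ - 1)

/-- `μ`: the mean of the hidden variables. -/
def meanHidden (τ hmin : ℝ) : ℝ := ∫ x, x ∂(hiddenLaw τ hmin)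

/-- The connection probability `min (h h' / (μ n)) 1`. -/
def connProb (τ hmin : ℝ) (n : ℕ) (h h' : ℝ) : ℝ :=
  min (h * h' / (meanHidden τ hmin * n)) 1

lemma connProb_comm (τ hmin : ℝ) (n : ℕ) (h h' : ℝ) :
    connProb τ hmin n h h' = connProb τ hmin n h' h := by
  unfold connProb
  rw [mul_comm h h']

/-- The sample space on `n` vertices: one hidden variable per vertex, and one number in `[0,1]`
per unordered pair of vertices (the coordinates of the diagonal pairs are not used). -/
abbrev Sample (n : ℕ) : Type := (Fin n → ℝ) × (Sym2 (Fin n) → unitInterval)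

/-- The probability on the sample space: the hidden variables are i.i.d. with law `hiddenLaw`,
and independently of them the numbers attached to the pairs are i.i.d. uniform on `[0,1]`. -/
def modelMeasure (τ hmin : ℝ) (n : ℕ) : Measure (Sample n) :=
  (Measure.pi fun _ : Fin n => hiddenLaw τ hmin).prod
    (Measure.pi fun _ : Sym2 (Fin n) => (volume : Measure unitInterval))

/-- The random graph: the pair `{i, j}` is joined when its uniform number is at most
the connection probability of `h i` and `h j`. Thus, conditionally on all the hidden variables,
the pairs are joined independently, each with its connection probability. -/
def modelGraph (τ hmin : ℝ) (n : ℕ) (ω : Sample n) : SimpleGraph (Fin n) where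
  Adj i j := i ≠ j ∧ (ω.2 s(i, j) : ℝ) ≤ connProb τ hmin n (ω.1 i) (ω.1 j)
  symm := ⟨fun i j hij => ⟨hij.1.symm, by
    rw [Sym2.eq_swap, connProb_comm]; exact hij.2⟩⟩
  loopless := ⟨fun _ hi => hi.1 rfl⟩

/-! ### Motif counts -/

/-- `E[N(H)]`, where `N(H)` is the number of (labelled, not necessarily induced) copies of `H`
in the random graph on `n` vertices. -/
def expCount (τ hmin : ℝ) {k : ℕ} (H : SimpleGraph (Fin k)) (n : ℕ) : ℝ :=
  ∫ ω, ((modelGraph τ hmin n ω).labelledCopyCount H : ℝ) ∂(modelMeasure τ hmin n)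

/-- `N(H, α, ε)`: the number of labelled copies of `H` in which, for every vertex `i` of `H`,
the vertex playing the role of `i` has its hidden variable in `[ε, 1/ε] n^{α i}`. -/
def windowCount (τ hmin : ℝ) {k : ℕ} (H : SimpleGraph (Fin k)) (α : Fin k → ℝ) (ε : ℝ)
    (n : ℕ) (ω : Sample n) : ℕ :=
  Nat.card {f : H.Copy (modelGraph τ hmin n ω) //
    ∀ i, ω.1 (f i) ∈ Set.Icc (ε * (n : ℝ) ^ α i) (1 / ε * (n : ℝ) ^ α i)}

/-- `E[N(H, α, ε)]`. -/
def expWindowCount (τ hmin : ℝ) {k : ℕ} (H : SimpleGraph (Fin k)) (α : Fin k → ℝ) (ε : ℝ)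
    (n : ℕ) : ℝ :=
  ∫ ω, (windowCount τ hmin H α ε n ω : ℝ) ∂(modelMeasure τ hmin n)

open Classical in
/-- `P(H)`: the probability that `H` is present on `k` vertices with i.i.d. hidden variables
`h₁, …, h_k`, as the integral of the product of the connection probabilities of the edges. -/
def motifProb (τ hmin : ℝ) {k : ℕ} (H : SimpleGraph (Fin k)) (n : ℕ) : ℝ :=
  ∫ h : Fin k → ℝ,
    ∏ q ∈ Finset.univ.filter (fun q : Fin k × Fin k => q.1 < q.2 ∧ H.Adj q.1 q.2),
      connProb τ hmin n (h q.1) (h q.2)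
    ∂(Measure.pi fun _ : Fin k => hiddenLaw τ hmin)

/-- The growth exponent `(3 - τ) k / 2 + (τ - 1) B_f(H) / 2`. -/
def growthExponent (τ : ℝ) {k : ℕ} (H : SimpleGraph (Fin k)) : ℝ :=
  (3 - τ) / 2 * k + (τ - 1) / 2 * Bf τ H

/-- The parameters `ε ∈ (0,1)`; when `S₁` is nonempty, the constant-order window `[ε, 1/ε]` is
also required to reach above the minimal hidden variable. -/
def Admissible (hmin : ℝ) {k : ℕ} (P : VertexPartition k) (ε : ℝ) : Prop :=
  0 < ε ∧ ε < 1 ∧ ((∃ i, P i = .S1) → hmin < 1 / ε)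

end HiddenVariable

end

/-!
In the logarithmic coordinates `y i = log (h i) - log (μ n) / 2` the product of the connection
probabilities over the edges of `H` is the exponential of a positively homogeneous piecewise
linear function. Cutting `y` at a threshold `θ` (class `S₂` above `θ`, class `S₁` below `-θ`,
class `S₃` in between) and integrating over `θ > 0` writes the exponent of the joint density of
the `h i` and of the edges as `τ - 1` times an integral of the objective over partitions. If a
single partition is optimal, this exponent therefore drops at least linearly in the distance of
`log h` to the profile of that partition, so the contribution of a set of hidden variables decays
exponentially in that logarithmic distance. Integrated against the Pareto laws, this decay gives
the order of `P(H)`, the concentration on the windows of the optimal profile, and the power saving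
for every other profile.
-/

noncomputable section

namespace HiddenVariable

/-! ### The sharp maximum of the piecewise linear objective -/

open scoped Topology in
lemma exists_pos_forall_le_sub_mul {α : Type*} [Finite α] {f d : α → ℝ} {a : α}
    (hf : ∀ x ≠ a, f x < f a) (hd : d a = 0) : ∃ c > 0, ∀ x, f x ≤ f a - c * d x := by
  have hev : ∀ x, ∀ᶠ c in 𝓝[>] (0 : ℝ), f x ≤ f a - c * d x := fun x ↦ by
    obtain rfl | hx := eq_or_ne x a
    · simp [hd]
    · have hlim : Tendsto (fun c : ℝ ↦ f a - c * d x) (𝓝 0) (𝓝 (f a - 0 * d x)) :=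
        Continuous.tendsto (by fun_prop) 0
      rw [zero_mul, sub_zero] at hlim
      exact ((hlim.eventually_const_lt (hf x hx)).mono fun _ ↦ le_of_lt).filter_mono
        nhdsWithin_le_nhds
  obtain ⟨c, hc, hc0⟩ := ((eventually_all.2 hev).and self_mem_nhdsWithin).exists
  exact ⟨c, hc0, hc⟩

instance : Finite Part :=
  Finite.of_surjective ![Part.S1, Part.S2, Part.S3] fun
    | .S1 => ⟨0, rfl⟩
    | .S2 => ⟨1, rfl⟩
    | .S3 => ⟨2, rfl⟩

/-- The sign of a class: twice the deviation of its exponent from `1 / 2`. -/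
def Part.sign : Part → ℝ
  | .S1 => -1
  | .S2 => 1
  | .S3 => 0

lemma Part.exponent_eq (s : Part) : s.exponent = 1 / 2 + s.sign / 2 := by
  cases s <;> norm_num [Part.exponent, Part.sign]

section SharpMaximum

variable {k : ℕ}

open Classical in
/-- The edges of `H`, each listed once with its smaller end first. -/
def edgePairs (H : SimpleGraph (Fin k)) : Finset (Fin k × Fin k) :=
  {q | q.1 < q.2 ∧ H.Adj q.1 q.2}

lemma mem_edgePairs {H : SimpleGraph (Fin k)} {q : Fin k × Fin k} :
    q ∈ edgePairs H ↔ q.1 < q.2 ∧ H.Adj q.1 q.2 := by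
  simp [edgePairs]

/-- The logarithm of the product of `min (exp (y i + y j)) 1` over the edges `{i, j}` of `H`. -/
def cappedEdgeSum (H : SimpleGraph (Fin k)) (y : Fin k → ℝ) : ℝ :=
  ∑ q ∈ edgePairs H, min (y q.1 + y q.2) 0

/-- The relaxation of `objective` to real vectors: the exponent of the density of the hidden
variables and of the edge probabilities in centred logarithmic coordinates. -/
def logWeight (τ : ℝ) (H : SimpleGraph (Fin k)) (y : Fin k → ℝ) : ℝ :=
  cappedEdgeSum H y - (τ - 1) * ∑ i, y i

open Classical in
lemma sum_sign (P : VertexPartition k) :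
    ∑ i, (P i).sign = (classSize P .S2 : ℝ) - classSize P .S1 := by
  rw [classSize, classSize, Finset.natCast_card_filter, Finset.natCast_card_filter,
    ← Finset.sum_sub_distrib]
  refine Finset.sum_congr rfl fun i _ ↦ ?_
  cases P i <;> simp [Part.sign]

open Classical in
lemma edgesInside_eq_sum (H : SimpleGraph (Fin k)) (P : VertexPartition k) (s : Part) :
    (edgesInside H P s : ℝ) = ∑ q ∈ edgePairs H, if P q.1 = s ∧ P q.2 = s then 1 else 0 := by
  simp only [edgesInside, edgePairs, ← and_assoc, Finset.natCast_card_filter, Finset.sum_filter,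
    ite_and]

open Classical in
lemma edgesBetween_eq_sum (H : SimpleGraph (Fin k)) (P : VertexPartition k) (s t : Part) :
    (edgesBetween H P s t : ℝ) = ∑ q ∈ edgePairs H,
      ((if P q.1 = s ∧ P q.2 = t then 1 else 0) + if P q.2 = s ∧ P q.1 = t then 1 else 0) := by
  have hswap : ∑ q ∈ edgePairs H, (if P q.2 = s ∧ P q.1 = t then (1 : ℝ) else 0) =
      ∑ q : Fin k × Fin k with q.2 < q.1 ∧ H.Adj q.2 q.1,
        if P q.1 = s ∧ P q.2 = t then 1 else 0 :=
    Finset.sum_equiv (Equiv.prodComm _ _) (by simp [mem_edgePairs]) fun _ _ ↦ rfl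
  rw [Finset.sum_add_distrib, hswap, edgePairs, Finset.sum_filter, Finset.sum_filter,
    ← Finset.sum_add_distrib, edgesBetween, Finset.natCast_card_filter]
  refine Finset.sum_congr rfl fun q _ ↦ ?_
  obtain hlt | heq | hgt := lt_trichotomy q.1 q.2
  · simp [hlt, hlt.not_gt, ite_and, H.adj_comm q.2]
  · simp [heq]
  · simp [hgt, hgt.not_gt, ite_and, H.adj_comm q.2]

open Classical in
lemma cappedEdgeSum_sign (H : SimpleGraph (Fin k)) (P : VertexPartition k) :
    cappedEdgeSum H (fun i ↦ (P i).sign) =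
      -(2 * (edgesInside H P .S1 : ℝ) + edgesBetween H P .S1 .S3) := by
  rw [edgesInside_eq_sum, edgesBetween_eq_sum, Finset.mul_sum, ← Finset.sum_add_distrib,
    ← Finset.sum_neg_distrib]
  refine Finset.sum_congr rfl fun q _ ↦ ?_
  dsimp only
  cases P q.1 <;> cases P q.2 <;> simp [Part.sign, ← neg_add, one_add_one_eq_two]

lemma logWeight_sign {τ : ℝ} (hτ : τ ≠ 1) (H : SimpleGraph (Fin k)) (P : VertexPartition k) :
    logWeight τ H (fun i ↦ (P i).sign) = (τ - 1) * objective τ H P := by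
  have : τ - 1 ≠ 0 := sub_ne_zero.2 hτ
  rw [logWeight, sum_sign, cappedEdgeSum_sign, objective]
  field_simp
  ring

/-- The class of a vertex with centred logarithmic coordinate `y` at the threshold `θ ≥ 0`. -/
def thresholdPart (y θ : ℝ) : Part :=
  if θ < y then .S2 else if θ < -y then .S1 else .S3

lemma integrableOn_indicator_Iio (a : ℝ) :
    IntegrableOn ((Set.Iio a).indicator (1 : ℝ → ℝ)) (Set.Ioi 0) := by
  rw [IntegrableOn, integrable_indicator_iff measurableSet_Iio, IntegrableOn,
    Measure.restrict_restrict measurableSet_Iio, Set.Iio_inter_Ioi]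
  exact integrableOn_const (by simp)

lemma setIntegral_indicator_Iio (a : ℝ) :
    ∫ θ in Set.Ioi 0, (Set.Iio a).indicator (1 : ℝ → ℝ) θ = max a 0 := by
  rw [integral_indicator_one measurableSet_Iio, measureReal_restrict_apply measurableSet_Iio,
    Set.Iio_inter_Ioi, Real.volume_real_Ioo, sub_zero]

lemma sign_thresholdPart_eqOn (y : ℝ) : Set.EqOn (fun θ ↦ (thresholdPart y θ).sign)
    ((Set.Iio y).indicator 1 - (Set.Iio (-y)).indicator 1) (Set.Ioi 0) := by
  intro θ (hθ : 0 < θ)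
  simp only [thresholdPart, Pi.sub_apply, Set.indicator_apply, Set.mem_Iio, Pi.one_apply]
  split_ifs <;> grind [Part.sign]

lemma integrableOn_sign_thresholdPart (y : ℝ) :
    IntegrableOn (fun θ ↦ (thresholdPart y θ).sign) (Set.Ioi 0) :=
  ((integrableOn_indicator_Iio y).sub (integrableOn_indicator_Iio (-y))).congr_fun
    (sign_thresholdPart_eqOn y).symm measurableSet_Ioi

lemma setIntegral_sign_thresholdPart (y : ℝ) :
    ∫ θ in Set.Ioi 0, (thresholdPart y θ).sign = y := by
  rw [setIntegral_congr_fun measurableSet_Ioi (sign_thresholdPart_eqOn y),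
    integral_sub' (integrableOn_indicator_Iio _) (integrableOn_indicator_Iio _),
    setIntegral_indicator_Iio, setIntegral_indicator_Iio]
  exact max_zero_sub_eq_self y

lemma min_sign_thresholdPart_eqOn (y z : ℝ) :
    Set.EqOn (fun θ ↦ min ((thresholdPart y θ).sign + (thresholdPart z θ).sign) 0)
      ((Set.Iio (min y (-z))).indicator 1 + (Set.Iio (min (-y) z)).indicator 1 -
        (Set.Iio (-y)).indicator 1 - (Set.Iio (-z)).indicator 1) (Set.Ioi 0) := by
  intro θ (hθ : 0 < θ)
  simp only [thresholdPart, Pi.sub_apply, Pi.add_apply, Set.indicator_apply, Set.mem_Iio,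
    Pi.one_apply, lt_min_iff]
  split_ifs <;> grind [Part.sign]

lemma integrableOn_min_sign_thresholdPart (y z : ℝ) :
    IntegrableOn (fun θ ↦ min ((thresholdPart y θ).sign + (thresholdPart z θ).sign) 0)
      (Set.Ioi 0) :=
  ((integrableOn_sign_thresholdPart y).add (integrableOn_sign_thresholdPart z)).inf
    (integrable_zero _ _ _)

lemma setIntegral_min_sign_thresholdPart (y z : ℝ) :
    ∫ θ in Set.Ioi 0, min ((thresholdPart y θ).sign + (thresholdPart z θ).sign) 0 =
      min (y + z) 0 := by
  have hint := integrableOn_indicator_Iio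
  rw [setIntegral_congr_fun measurableSet_Ioi (min_sign_thresholdPart_eqOn y z),
    integral_sub' (((hint _).add (hint _)).sub (hint _)) (hint _),
    integral_sub' ((hint _).add (hint _)) (hint _), integral_add' (hint _) (hint _)]
  simp only [setIntegral_indicator_Iio]
  grind

lemma integrableOn_logWeight_thresholdPart (τ : ℝ) (H : SimpleGraph (Fin k)) (y : Fin k → ℝ) :
    IntegrableOn (fun θ ↦ logWeight τ H fun i ↦ (thresholdPart (y i) θ).sign) (Set.Ioi 0) :=
  (integrable_finsetSum _ fun (q : Fin k × Fin k) _ ↦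
    integrableOn_min_sign_thresholdPart (y q.1) (y q.2)).sub
    ((integrable_finsetSum _ fun i _ ↦ integrableOn_sign_thresholdPart (y i)).const_mul _)

/-- The integrand is the weight of a partition for every `θ > 0`, which is what turns the
combinatorial optimum into a bound for real vectors. -/
lemma setIntegral_logWeight_thresholdPart (τ : ℝ) (H : SimpleGraph (Fin k)) (y : Fin k → ℝ) :
    ∫ θ in Set.Ioi 0, logWeight τ H (fun i ↦ (thresholdPart (y i) θ).sign) = logWeight τ H y := by
  have hsign (i : Fin k) := integrableOn_sign_thresholdPart (y i)
  have hmin (q : Fin k × Fin k) := integrableOn_min_sign_thresholdPart (y q.1) (y q.2)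
  simp only [logWeight, cappedEdgeSum]
  rw [integral_sub (integrable_finsetSum _ fun q _ ↦ hmin q)
      ((integrable_finsetSum _ fun i _ ↦ hsign i).const_mul _),
    integral_const_mul, integral_finsetSum _ fun q _ ↦ hmin q,
    integral_finsetSum _ fun i _ ↦ hsign i]
  simp only [setIntegral_sign_thresholdPart, setIntegral_min_sign_thresholdPart]

/-- `P` is the only partition that attains the maximum of the objective, in the form in which
uniqueness enters the estimates. -/
def IsUniqueOptimal (τ : ℝ) (H : SimpleGraph (Fin k)) (P : VertexPartition k) : Prop :=
  ∀ Q, Q ≠ P → objective τ H Q < objective τ H P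

lemma IsOptimal.isUniqueOptimal {τ : ℝ} {H : SimpleGraph (Fin k)} {P : VertexPartition k}
    (hopt : IsOptimal τ H P) (huniq : ∀ Q, IsOptimal τ H Q → Q = P) : IsUniqueOptimal τ H P :=
  fun Q hQ ↦ (hopt Q).lt_of_ne fun h ↦ hQ <| huniq Q fun R ↦ (hopt R).trans_eq h.symm

lemma IsUniqueOptimal.isOptimal {τ : ℝ} {H : SimpleGraph (Fin k)} {P : VertexPartition k}
    (hP : IsUniqueOptimal τ H P) : IsOptimal τ H P := fun Q ↦ by
  obtain rfl | hQ := eq_or_ne Q P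
  exacts [le_rfl, (hP Q hQ).le]

lemma logWeight_of_nonneg {τ : ℝ} (H : SimpleGraph (Fin k)) {y : Fin k → ℝ}
    (hy : ∀ i, 0 ≤ y i) : logWeight τ H y = -(τ - 1) * ∑ i, |y i| := by
  have hedge : cappedEdgeSum H y = 0 :=
    Finset.sum_eq_zero fun q _ ↦ min_eq_right (add_nonneg (hy _) (hy _))
  simp only [logWeight, hedge, abs_of_nonneg (hy _), zero_sub, neg_mul]

/-- The threshold partitions above the level `L` have no vertex in `S₁`, so there the optimal
partition is replaced by the one whose signs all vanish. -/
lemma exists_logWeight_thresholdPart_le {τ : ℝ} (hτ : 1 < τ) {H : SimpleGraph (Fin k)}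
    {P : VertexPartition k} (hP : IsUniqueOptimal τ H P) :
    ∃ c > 0, ∀ (L : ℝ) (y : Fin k → ℝ), (∀ i, -L ≤ y i) → ∀ θ,
      logWeight τ H (fun i ↦ (thresholdPart (y i) θ).sign) ≤
        (Set.Iio L).indicator 1 θ * logWeight τ H (fun i ↦ (P i).sign) -
          c * ∑ i, |(thresholdPart (y i) θ).sign - (Set.Iio L).indicator 1 θ * (P i).sign| := by
  obtain ⟨c, hc, hgap⟩ := exists_pos_forall_le_sub_mul
    (f := fun Q : VertexPartition k ↦ logWeight τ H fun i ↦ (Q i).sign)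
    (d := fun Q ↦ ∑ i, |(Q i).sign - (P i).sign|) (a := P)
    (fun Q hQ ↦ by
      simp only [logWeight_sign hτ.ne']
      exact mul_lt_mul_of_pos_left (hP Q hQ) (sub_pos.2 hτ))
    (by simp)
  refine ⟨min c (τ - 1), lt_min hc (sub_pos.2 hτ), fun L y hy θ ↦ ?_⟩
  by_cases hL : θ < L
  · simp only [Set.indicator_of_mem (Set.mem_Iio.2 hL), Pi.one_apply, one_mul]
    refine (hgap fun i ↦ thresholdPart (y i) θ).trans (sub_le_sub_left ?_ _)
    gcongr
    exact min_le_left _ _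
  · have hsign (i : Fin k) : 0 ≤ (thresholdPart (y i) θ).sign := by
      have : ¬ θ < -y i := by linarith [hy i]
      unfold thresholdPart
      split_ifs <;> simp [Part.sign]
    simp only [Set.indicator_of_notMem (mt Set.mem_Iio.1 hL), zero_mul, sub_zero, zero_sub]
    rw [logWeight_of_nonneg H hsign, neg_mul, neg_le_neg_iff]
    gcongr
    exact min_le_right _ _

lemma abs_sub_mul_le_setIntegral_thresholdPart (y σ : ℝ) {L : ℝ} (hL : 0 ≤ L) :
    |y - L * σ| ≤
      ∫ θ in Set.Ioi 0, |(thresholdPart y θ).sign - (Set.Iio L).indicator 1 θ * σ| := by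
  calc |y - L * σ|
      = |∫ θ in Set.Ioi 0, ((thresholdPart y θ).sign - (Set.Iio L).indicator 1 θ * σ)| := by
        rw [integral_sub (integrableOn_sign_thresholdPart y)
          ((integrableOn_indicator_Iio L).mul_const σ), setIntegral_sign_thresholdPart,
          integral_mul_const, setIntegral_indicator_Iio, max_eq_left hL]
    _ ≤ _ := abs_integral_le_integral_abs

theorem exists_logWeight_le {τ : ℝ} (hτ : 1 < τ) {H : SimpleGraph (Fin k)}
    {P : VertexPartition k} (hP : IsUniqueOptimal τ H P) :
    ∃ c > 0, ∀ L ≥ 0, ∀ y : Fin k → ℝ, (∀ i, -L ≤ y i) →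
      logWeight τ H y ≤
        L * logWeight τ H (fun i ↦ (P i).sign) - c * ∑ i, |y i - L * (P i).sign| := by
  obtain ⟨c, hc, hle⟩ := exists_logWeight_thresholdPart_le hτ hP
  refine ⟨c, hc, fun L hL y hy ↦ ?_⟩
  have hind := integrableOn_indicator_Iio L
  have hdist (i : Fin k) : IntegrableOn (fun θ ↦ |(thresholdPart (y i) θ).sign -
      (Set.Iio L).indicator 1 θ * (P i).sign|) (Set.Ioi 0) :=
    ((integrableOn_sign_thresholdPart (y i)).sub (hind.mul_const _)).abs
  have hsum := (integrable_finsetSum Finset.univ fun i _ ↦ hdist i).const_mul c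
  calc logWeight τ H y
      = ∫ θ in Set.Ioi 0, logWeight τ H fun i ↦ (thresholdPart (y i) θ).sign :=
        (setIntegral_logWeight_thresholdPart τ H y).symm
    _ ≤ ∫ θ in Set.Ioi 0, ((Set.Iio L).indicator 1 θ * logWeight τ H (fun i ↦ (P i).sign) -
          c * ∑ i, |(thresholdPart (y i) θ).sign - (Set.Iio L).indicator 1 θ * (P i).sign|) :=
        setIntegral_mono_on (integrableOn_logWeight_thresholdPart τ H y)
          ((hind.mul_const _).sub hsum) measurableSet_Ioi fun θ _ ↦ hle L y hy θ
    _ = L * logWeight τ H (fun i ↦ (P i).sign) - c * ∑ i,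
          ∫ θ in Set.Ioi 0, |(thresholdPart (y i) θ).sign - (Set.Iio L).indicator 1 θ *
            (P i).sign| := by
        rw [integral_sub (hind.mul_const _) hsum, integral_mul_const, integral_const_mul,
          setIntegral_indicator_Iio, max_eq_left hL, integral_finsetSum _ fun i _ ↦ hdist i]
    _ ≤ _ := by
        gcongr with i
        exact abs_sub_mul_le_setIntegral_thresholdPart (y i) (P i).sign hL

end SharpMaximum

/-! ### Pareto laws -/

section Pareto

open ProbabilityTheory

variable {t r : ℝ}

lemma paretoMeasure_eq_withDensity_restrict (t r : ℝ) :
    paretoMeasure t r = (volume.restrict (Set.Ioi t)).withDensity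
      fun x ↦ ENNReal.ofReal (r * t ^ r * x ^ (-(r + 1))) := by
  have hpdf : paretoPDF t r =
      (Set.Ici t).indicator fun x ↦ ENNReal.ofReal (r * t ^ r * x ^ (-(r + 1))) := by
    ext x
    rw [paretoPDF_eq, Set.indicator_apply, apply_ite ENNReal.ofReal, ENNReal.ofReal_zero]
    rfl
  rw [paretoMeasure, hpdf, withDensity_indicator measurableSet_Ici,
    restrict_Ioi_eq_restrict_Ici]

lemma ae_lt_paretoMeasure (t r : ℝ) : ∀ᵐ x ∂paretoMeasure t r, t < x := by
  rw [paretoMeasure_eq_withDensity_restrict]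
  exact (withDensity_absolutelyContinuous _ _).ae_le (ae_restrict_mem measurableSet_Ioi)

lemma ae_restrict_toReal_paretoDensity (ht : 0 < t) (hr : 0 < r) (g : ℝ → ℝ) :
    (fun x ↦ (ENNReal.ofReal (r * t ^ r * x ^ (-(r + 1)))).toReal • g x)
      =ᵐ[volume.restrict (Set.Ioi t)] fun x ↦ r * t ^ r * (x ^ (-(r + 1)) * g x) := by
  filter_upwards [ae_restrict_mem measurableSet_Ioi] with x hx
  have : 0 < x := ht.trans hx
  rw [ENNReal.toReal_ofReal (by positivity), smul_eq_mul, mul_assoc]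

lemma integral_paretoMeasure (ht : 0 < t) (hr : 0 < r) (g : ℝ → ℝ) :
    ∫ x, g x ∂paretoMeasure t r =
      r * t ^ r * ∫ x in Set.Ioi t, x ^ (-(r + 1)) * g x := by
  rw [paretoMeasure_eq_withDensity_restrict,
    integral_withDensity_eq_integral_toReal_smul (by fun_prop) (by simp),
    integral_congr_ae (ae_restrict_toReal_paretoDensity ht hr g), integral_const_mul]

lemma integrable_paretoMeasure (ht : 0 < t) (hr : 0 < r) {g : ℝ → ℝ}
    (hg : IntegrableOn (fun x ↦ x ^ (-(r + 1)) * g x) (Set.Ioi t)) :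
    Integrable g (paretoMeasure t r) := by
  rw [paretoMeasure_eq_withDensity_restrict,
    integrable_withDensity_iff_integrable_smul' (by fun_prop) (by simp)]
  exact (hg.const_mul _).congr (ae_restrict_toReal_paretoDensity ht hr g).symm

lemma integral_id_paretoMeasure (ht : 0 < t) (hr : 1 < r) :
    ∫ x, x ∂paretoMeasure t r = r * t / (r - 1) := by
  have hpow : Set.EqOn (fun x : ℝ ↦ x ^ (-(r + 1)) * x) (fun x ↦ x ^ (-r)) (Set.Ioi t) :=
    fun x hx ↦ by
      have hx0 : x ≠ 0 := (ht.trans hx).ne'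
      beta_reduce
      rw [← Real.rpow_add_one hx0]
      ring_nf
  rw [integral_paretoMeasure ht (by linarith), setIntegral_congr_fun measurableSet_Ioi hpow,
    integral_Ioi_rpow_of_lt (by linarith) ht, Real.rpow_add_one ht.ne', Real.rpow_neg ht.le]
  have : r - 1 ≠ 0 := by linarith
  have : -r + 1 ≠ 0 := by linarith
  field_simp
  ring

lemma paretoMeasure_real_Icc (ht : 0 < t) (hr : 0 < r) {a b : ℝ} (ha : t < a) (hab : a ≤ b) :
    (paretoMeasure t r).real (Set.Icc a b) = t ^ r * (a ^ (-r) - b ^ (-r)) := by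
  have hzero : (0 : ℝ) ∉ Set.uIcc a b := by
    rw [Set.uIcc_of_le hab]
    exact fun h ↦ (ht.trans ha).not_ge h.1
  have hind : (fun x : ℝ ↦ x ^ (-(r + 1)) * (Set.Icc a b).indicator 1 x) =
      (Set.Icc a b).indicator fun x ↦ x ^ (-(r + 1)) := by
    ext x
    simp only [Set.indicator_apply, Pi.one_apply, mul_ite, mul_one, mul_zero]
  have hsub : Set.Icc a b ⊆ Set.Ioi t := fun x hx ↦ ha.trans_le hx.1
  rw [← integral_indicator_one measurableSet_Icc, integral_paretoMeasure ht hr, hind,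
    setIntegral_indicator measurableSet_Icc, Set.inter_eq_right.2 hsub,
    integral_Icc_eq_integral_Ioc, ← intervalIntegral.integral_of_le hab,
    integral_rpow (Or.inr ⟨by linarith, hzero⟩)]
  simp only [neg_add_rev, neg_add_cancel_comm]
  field_simp
  ring

/-- The two-sided exponential profile around the logarithmic scale `ℓ`, divided by the factor
`exp (-r * (log x - ℓ))` by which a Pareto tail of shape `r` decreases from that scale to `x`. -/
def scaleWeight (r a ℓ x : ℝ) : ℝ :=
  Real.exp (r * (Real.log x - ℓ) - a * |Real.log x - ℓ|)

lemma integral_exp_neg_mul_abs_sub {a : ℝ} (ha : 0 < a) (ℓ : ℝ) :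
    ∫ u, Real.exp (-a * |u - ℓ|) = 2 / a := by
  rw [integral_sub_right_eq_self fun u ↦ Real.exp (-a * |u|),
    integral_comp_abs (f := fun u ↦ Real.exp (-a * u)), integral_exp_mul_Ioi (neg_lt_zero.2 ha)]
  simp [div_eq_mul_inv]

lemma setIntegral_rpow_mul_scaleWeight (r : ℝ) {a : ℝ} (ha : 0 < a) (ℓ : ℝ) :
    ∫ x in Set.Ioi 0, x ^ (-(r + 1)) * scaleWeight r a ℓ x = Real.exp (-r * ℓ) * (2 / a) := by
  rw [← Real.range_exp, ← Set.image_univ, integral_image_eq_integral_abs_deriv_smul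
    MeasurableSet.univ (fun u _ ↦ (Real.hasDerivAt_exp u).hasDerivWithinAt)
    Real.exp_injective.injOn, setIntegral_univ, ← integral_exp_neg_mul_abs_sub ha ℓ,
    ← integral_const_mul]
  refine integral_congr_ae (.of_forall fun u ↦ ?_)
  simp only [scaleWeight, Real.abs_exp, smul_eq_mul, Real.log_exp, ← Real.exp_mul, ← Real.exp_add]
  ring_nf

lemma integrableOn_rpow_mul_scaleWeight (r : ℝ) {a : ℝ} (ha : 0 < a) (ℓ : ℝ) :
    IntegrableOn (fun x ↦ x ^ (-(r + 1)) * scaleWeight r a ℓ x) (Set.Ioi 0) :=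
  Integrable.of_integral_ne_zero <| by
    rw [setIntegral_rpow_mul_scaleWeight r ha]
    positivity

lemma integrable_scaleWeight (ht : 0 < t) (hr : 0 < r) {a : ℝ} (ha : 0 < a) (ℓ : ℝ) :
    Integrable (scaleWeight r a ℓ) (paretoMeasure t r) :=
  integrable_paretoMeasure ht hr <|
    (integrableOn_rpow_mul_scaleWeight r ha ℓ).mono_set (Set.Ioi_subset_Ioi ht.le)

lemma integral_scaleWeight_le (ht : 0 < t) (hr : 0 < r) {a : ℝ} (ha : 0 < a) (ℓ : ℝ) :
    ∫ x, scaleWeight r a ℓ x ∂paretoMeasure t r ≤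
      r * t ^ r * (Real.exp (-r * ℓ) * (2 / a)) := by
  rw [integral_paretoMeasure ht hr, ← setIntegral_rpow_mul_scaleWeight r ha ℓ]
  gcongr
  · filter_upwards [ae_restrict_mem measurableSet_Ioi] with x hx
    exact mul_nonneg (Real.rpow_nonneg (le_of_lt hx) _) (Real.exp_nonneg _)
  · exact integrableOn_rpow_mul_scaleWeight r ha ℓ

end Pareto

/-! ### Expected counts as integrals -/

section ProductMeasure

open ProbabilityTheory

lemma measurableSet_and_forall_coe_le {ι κ α : Type*} [Finite ι] [MeasurableSpace α]
    (g : ι → κ) {p : ι → α → ℝ} (hpm : ∀ i, Measurable (p i)) {A : Set α} (hA : MeasurableSet A) :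
    MeasurableSet {ω : α × (κ → unitInterval) | ω.1 ∈ A ∧ ∀ i, (ω.2 (g i) : ℝ) ≤ p i ω.1} :=
  (measurable_fst hA).inter <| measurableSet_setOfPred.2 <| .forall fun i ↦
    measurableSet_setOfPred.1 <| measurableSet_le (by fun_prop) ((hpm i).comp measurable_fst)

variable {ι κ α : Type*} [Fintype ι] [Fintype κ] [MeasurableSpace α] {g : ι → κ}

lemma map_comp_pi (ν : Measure α) [IsProbabilityMeasure ν] (hg : g.Injective) :
    (Measure.pi fun _ : κ ↦ ν).map (fun h ↦ h ∘ g) = Measure.pi fun _ : ι ↦ ν := by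
  have hindep : iIndepFun (fun (i : κ) (h : κ → α) ↦ h i) (Measure.pi fun _ : κ ↦ ν) :=
    iIndepFun_pi (X := fun _ x ↦ x) fun _ ↦ aemeasurable_id
  refine ((iIndepFun_iff_map_fun_eq_pi_map fun i ↦
    (measurable_pi_apply (g i)).aemeasurable).1 (hindep.precomp hg)).trans ?_
  simp only [(measurePreserving_eval (fun _ : κ ↦ ν) _).map_eq]

lemma measureReal_pi_forall_coe_le (hg : g.Injective) {p : ι → ℝ}
    (hp : ∀ i, p i ∈ Set.Icc 0 1) :
    (Measure.pi fun _ : κ ↦ (volume : Measure unitInterval)).real {u | ∀ i, (u (g i) : ℝ) ≤ p i} =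
      ∏ i, p i := by
  have hpre : {u : κ → unitInterval | ∀ i, (u (g i) : ℝ) ≤ p i} =
      (fun u ↦ u ∘ g) ⁻¹' Set.univ.pi fun i ↦ Set.Iic ⟨p i, hp i⟩ := by
    ext u
    rw [Set.mem_preimage, Set.mem_univ_pi]
    rfl
  rw [hpre, measureReal_def, ← Measure.map_apply (by fun_prop)
    (MeasurableSet.univ_pi fun _ ↦ measurableSet_Iic), map_comp_pi volume hg, Measure.pi_pi,
    ENNReal.toReal_prod]
  simp only [unitInterval.volume_Iic, ENNReal.toReal_ofReal (hp _).1]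

lemma measureReal_prod_forall_coe_le (hg : g.Injective) {ν : Measure α}
    {p : ι → α → ℝ} (hpm : ∀ i, Measurable (p i)) (hp : ∀ᵐ x ∂ν, ∀ i, p i x ∈ Set.Icc 0 1)
    {A : Set α} (hA : MeasurableSet A) :
    (ν.prod (Measure.pi fun _ : κ ↦ (volume : Measure unitInterval))).real
        {ω | ω.1 ∈ A ∧ ∀ i, (ω.2 (g i) : ℝ) ≤ p i ω.1} =
      ∫ x in A, ∏ i, p i x ∂ν := by
  have hm := measurableSet_and_forall_coe_le g hpm hA
  rw [measureReal_def, Measure.prod_apply hm, ← integral_toReal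
    (measurable_measure_prodMk_left hm).aemeasurable (.of_forall fun _ ↦ measure_lt_top _ _),
    ← integral_indicator hA]
  refine integral_congr_ae ?_
  filter_upwards [hp] with x hx
  by_cases hxA : x ∈ A
  · rw [Set.indicator_of_mem hxA, ← measureReal_pi_forall_coe_le hg hx, measureReal_def]
    simp only [Set.preimage_ofPred_eq, hxA, true_and]
  · simp [hxA]

end ProductMeasure

section Model

variable {τ hmin : ℝ} {k : ℕ}

lemma isProbabilityMeasure_hiddenLaw (hτ : 1 < τ) (hmin_pos : 0 < hmin) :
    IsProbabilityMeasure (hiddenLaw τ hmin) :=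
  ProbabilityTheory.isProbabilityMeasure_paretoMeasure hmin_pos (sub_pos.2 hτ)

/-- The joint law of the hidden variables of the vertices of a motif. -/
abbrev hiddenLawPi (τ hmin : ℝ) (k : ℕ) : Measure (Fin k → ℝ) :=
  Measure.pi fun _ ↦ hiddenLaw τ hmin

lemma ae_lt_hiddenLawPi (hτ : 1 < τ) (hmin_pos : 0 < hmin) (k : ℕ) :
    ∀ᵐ h ∂hiddenLawPi τ hmin k, ∀ i, hmin < h i := by
  have := isProbabilityMeasure_hiddenLaw hτ hmin_pos
  exact eventually_all.2 fun i ↦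
    Measure.tendsto_eval_ae_ae.eventually (ae_lt_paretoMeasure hmin (τ - 1))

lemma meanHidden_nonneg (τ : ℝ) (hmin_pos : 0 < hmin) : 0 ≤ meanHidden τ hmin :=
  integral_nonneg_of_ae <| (ae_lt_paretoMeasure hmin (τ - 1)).mono fun _ hx ↦
    (hmin_pos.trans hx).le

lemma meanHidden_pos (hτ : 2 < τ) (hmin_pos : 0 < hmin) : 0 < meanHidden τ hmin := by
  rw [meanHidden, hiddenLaw, integral_id_paretoMeasure hmin_pos (by linarith)]
  exact div_pos (mul_pos (by linarith) hmin_pos) (by linarith)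

lemma measurable_connProb (τ hmin : ℝ) (n : ℕ) {α : Type*} [MeasurableSpace α] {f g : α → ℝ}
    (hf : Measurable f) (hg : Measurable g) :
    Measurable fun x ↦ connProb τ hmin n (f x) (g x) := by
  unfold connProb
  fun_prop

lemma connProb_mem_Icc (τ : ℝ) (hmin_pos : 0 < hmin) (n : ℕ) {x y : ℝ} (hx : 0 ≤ x)
    (hy : 0 ≤ y) : connProb τ hmin n x y ∈ Set.Icc 0 1 := by
  have := meanHidden_nonneg τ hmin_pos
  exact ⟨by unfold connProb; positivity, min_le_right _ _⟩

/-- The conditional probability, given the hidden variables `h` of `k` vertices, that these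
vertices form a copy of `H`. -/
def edgeProd (τ hmin : ℝ) (H : SimpleGraph (Fin k)) (n : ℕ) (h : Fin k → ℝ) : ℝ :=
  ∏ q ∈ edgePairs H, connProb τ hmin n (h q.1) (h q.2)

lemma measurable_edgeProd (τ hmin : ℝ) (H : SimpleGraph (Fin k)) (n : ℕ) :
    Measurable (edgeProd τ hmin H n) :=
  Finset.measurable_prod _ fun _ _ ↦
    measurable_connProb τ hmin n (measurable_pi_apply _) (measurable_pi_apply _)

lemma edgeProd_mem_Icc (τ : ℝ) (hmin_pos : 0 < hmin) (H : SimpleGraph (Fin k)) (n : ℕ)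
    {h : Fin k → ℝ} (hh : ∀ i, 0 ≤ h i) : edgeProd τ hmin H n h ∈ Set.Icc 0 1 :=
  have hmem (q : Fin k × Fin k) := connProb_mem_Icc τ hmin_pos n (hh q.1) (hh q.2)
  ⟨Finset.prod_nonneg fun q _ ↦ (hmem q).1,
    Finset.prod_le_one (fun q _ ↦ (hmem q).1) fun q _ ↦ (hmem q).2⟩

lemma ae_edgeProd_mem_Icc (hτ : 1 < τ) (hmin_pos : 0 < hmin) (H : SimpleGraph (Fin k)) (n : ℕ) :
    ∀ᵐ h ∂hiddenLawPi τ hmin k, edgeProd τ hmin H n h ∈ Set.Icc 0 1 :=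
  (ae_lt_hiddenLawPi hτ hmin_pos k).mono fun _ hh ↦
    edgeProd_mem_Icc τ hmin_pos H n fun i ↦ (hmin_pos.trans (hh i)).le

lemma integrable_edgeProd (hτ : 1 < τ) (hmin_pos : 0 < hmin) (H : SimpleGraph (Fin k)) (n : ℕ) :
    Integrable (edgeProd τ hmin H n) (hiddenLawPi τ hmin k) := by
  have := isProbabilityMeasure_hiddenLaw hτ hmin_pos
  refine Integrable.of_bound (measurable_edgeProd τ hmin H n).aestronglyMeasurable 1 ?_
  filter_upwards [ae_edgeProd_mem_Icc hτ hmin_pos H n] with h hh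
  rw [Real.norm_of_nonneg hh.1]
  exact hh.2

/-- The probability that `k` given vertices form a copy of `H` with hidden variables in `B`. -/
def motifProbOn (τ hmin : ℝ) (H : SimpleGraph (Fin k)) (n : ℕ) (B : Set (Fin k → ℝ)) : ℝ :=
  ∫ h in B, edgeProd τ hmin H n h ∂hiddenLawPi τ hmin k

lemma motifProbOn_univ (τ hmin : ℝ) (H : SimpleGraph (Fin k)) (n : ℕ) :
    motifProbOn τ hmin H n Set.univ = motifProb τ hmin H n := by
  rw [motifProbOn, setIntegral_univ]
  rfl

lemma motifProbOn_nonneg (hτ : 1 < τ) (hmin_pos : 0 < hmin) (H : SimpleGraph (Fin k)) (n : ℕ)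
    (B : Set (Fin k → ℝ)) : 0 ≤ motifProbOn τ hmin H n B :=
  setIntegral_nonneg_of_ae <| (ae_edgeProd_mem_Icc hτ hmin_pos H n).mono fun _ h ↦ h.1

lemma motifProbOn_mono (hτ : 1 < τ) (hmin_pos : 0 < hmin) (H : SimpleGraph (Fin k)) (n : ℕ)
    {A B : Set (Fin k → ℝ)} (hAB : A ⊆ B) :
    motifProbOn τ hmin H n A ≤ motifProbOn τ hmin H n B :=
  setIntegral_mono_set (integrable_edgeProd hτ hmin_pos H n).integrableOn
    (ae_restrict_of_ae <| (ae_edgeProd_mem_Icc hτ hmin_pos H n).mono fun _ h ↦ h.1)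
    hAB.eventuallyLE

lemma motifProb_nonneg (hτ : 1 < τ) (hmin_pos : 0 < hmin) (H : SimpleGraph (Fin k)) (n : ℕ) :
    0 ≤ motifProb τ hmin H n :=
  motifProbOn_univ τ hmin H n ▸ motifProbOn_nonneg hτ hmin_pos H n _

lemma motifProbOn_le_motifProb (hτ : 1 < τ) (hmin_pos : 0 < hmin) (H : SimpleGraph (Fin k))
    (n : ℕ) (B : Set (Fin k → ℝ)) : motifProbOn τ hmin H n B ≤ motifProb τ hmin H n :=
  motifProbOn_univ τ hmin H n ▸ motifProbOn_mono hτ hmin_pos H n (Set.subset_univ B)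

lemma motifProbOn_add_compl (hτ : 1 < τ) (hmin_pos : 0 < hmin) (H : SimpleGraph (Fin k))
    (n : ℕ) {B : Set (Fin k → ℝ)} (hB : MeasurableSet B) :
    motifProbOn τ hmin H n B + motifProbOn τ hmin H n Bᶜ = motifProb τ hmin H n := by
  rw [← motifProbOn_univ, motifProbOn, motifProbOn, motifProbOn, setIntegral_univ]
  exact integral_add_compl hB (integrable_edgeProd hτ hmin_pos H n)

/-- The labelled copies of `A` in `B` are the injections of the vertices that respect adjacency. -/
def copyEquiv {V W : Type*} (A : SimpleGraph V) (B : SimpleGraph W) :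
    A.Copy B ≃ {f : V ↪ W // ∀ a b, A.Adj a b → B.Adj (f a) (f b)} where
  toFun f := ⟨f.toEmbedding, fun _ _ hab ↦ f.toHom.map_adj hab⟩
  invFun f := ⟨⟨f.1, fun hab ↦ f.2 _ _ hab⟩, f.1.injective⟩
  left_inv _ := rfl
  right_inv _ := rfl

/-- The event that the placement `f` is a copy of `H` with hidden variables in `B`. -/
def copyEvent (τ hmin : ℝ) (H : SimpleGraph (Fin k)) {n : ℕ} (B : Set (Fin k → ℝ))
    (f : Fin k ↪ Fin n) : Set (Sample n) :=
  {ω | ω.1 ∘ f ∈ B ∧ ∀ a b, H.Adj a b → (modelGraph τ hmin n ω).Adj (f a) (f b)}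

lemma copyEvent_eq (τ hmin : ℝ) (H : SimpleGraph (Fin k)) {n : ℕ} (B : Set (Fin k → ℝ))
    (f : Fin k ↪ Fin n) :
    copyEvent τ hmin H B f = {ω | ω.1 ∈ (fun h ↦ h ∘ f) ⁻¹' B ∧ ∀ q : edgePairs H,
      (ω.2 s(f q.1.1, f q.1.2) : ℝ) ≤ connProb τ hmin n (ω.1 (f q.1.1)) (ω.1 (f q.1.2))} := by
  ext ω
  refine and_congr_right fun _ ↦ ⟨fun hω q ↦ (hω _ _ (mem_edgePairs.1 q.2).2).2,
    fun hω a b hab ↦ ?_⟩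
  wlog hlt : a < b generalizing a b
  · exact (this b a hab.symm ((le_of_not_gt hlt).lt_of_ne hab.ne.symm)).symm
  · exact ⟨f.injective.ne hab.ne, hω ⟨(a, b), mem_edgePairs.2 ⟨hlt, hab⟩⟩⟩

lemma injective_sym2_edgePairs {W : Type*} (H : SimpleGraph (Fin k)) (f : Fin k ↪ W) :
    Function.Injective fun q : edgePairs H ↦ s(f q.1.1, f q.1.2) := by
  rintro ⟨⟨a, b⟩, hab⟩ ⟨⟨c, d⟩, hcd⟩ heq
  simp only [Sym2.eq_iff, f.injective.eq_iff] at heq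
  obtain ⟨rfl, rfl⟩ | ⟨rfl, rfl⟩ := heq
  · rfl
  · exact absurd (mem_edgePairs.1 hab).1 (mem_edgePairs.1 hcd).1.not_gt

lemma measurableSet_copyEvent (τ hmin : ℝ) (H : SimpleGraph (Fin k)) {n : ℕ}
    {B : Set (Fin k → ℝ)} (hB : MeasurableSet B) (f : Fin k ↪ Fin n) :
    MeasurableSet (copyEvent τ hmin H B f) := by
  rw [copyEvent_eq]
  exact measurableSet_and_forall_coe_le (fun q : edgePairs H ↦ s(f q.1.1, f q.1.2))
    (fun q ↦ measurable_connProb τ hmin n (measurable_pi_apply _) (measurable_pi_apply _))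
    (hB.preimage (by fun_prop : Measurable fun h : Fin n → ℝ ↦ h ∘ f))

lemma modelMeasure_real_copyEvent (hτ : 1 < τ) (hmin_pos : 0 < hmin) (H : SimpleGraph (Fin k))
    {n : ℕ} {B : Set (Fin k → ℝ)} (hB : MeasurableSet B) (f : Fin k ↪ Fin n) :
    (modelMeasure τ hmin n).real (copyEvent τ hmin H B f) = motifProbOn τ hmin H n B := by
  have := isProbabilityMeasure_hiddenLaw hτ hmin_pos
  have hf : Measurable fun h : Fin n → ℝ ↦ h ∘ f := by fun_prop
  rw [copyEvent_eq, modelMeasure, measureReal_prod_forall_coe_le (injective_sym2_edgePairs H f)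
      (fun q ↦ measurable_connProb τ hmin n (measurable_pi_apply _) (measurable_pi_apply _))
      _ (hf hB),
    motifProbOn, hiddenLawPi, ← map_comp_pi (hiddenLaw τ hmin) f.injective,
    setIntegral_map hB (measurable_edgeProd τ hmin H n).aestronglyMeasurable hf.aemeasurable]
  · simp only [edgeProd, ← Finset.prod_coe_sort (edgePairs H), Function.comp_apply]
  · filter_upwards [ae_lt_hiddenLawPi hτ hmin_pos n] with h hh q
    exact connProb_mem_Icc τ hmin_pos n (hmin_pos.trans (hh _)).le (hmin_pos.trans (hh _)).le

open Classical in
lemma card_copy_eq_sum (τ hmin : ℝ) (H : SimpleGraph (Fin k)) {n : ℕ} (B : Set (Fin k → ℝ))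
    (ω : Sample n) :
    (Nat.card {f : H.Copy (modelGraph τ hmin n ω) // ω.1 ∘ f ∈ B} : ℝ) =
      ∑ f : Fin k ↪ Fin n, (copyEvent τ hmin H B f).indicator 1 ω := by
  have e : {f : H.Copy (modelGraph τ hmin n ω) // ω.1 ∘ f ∈ B} ≃
      {f : Fin k ↪ Fin n // ω ∈ copyEvent τ hmin H B f} :=
    ((copyEquiv H _).subtypeEquiv fun _ ↦ Iff.rfl).trans <|
      (Equiv.subtypeSubtypeEquivSubtypeInter _ fun f : Fin k ↪ Fin n ↦ ω.1 ∘ f ∈ B).trans <|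
        Equiv.subtypeEquivRight fun _ ↦ and_comm
  rw [Nat.card_congr e, Nat.card_eq_fintype_card, Fintype.card_subtype,
    Finset.natCast_card_filter]
  simp only [Set.indicator_apply, Pi.one_apply]

theorem integral_card_copy (hτ : 1 < τ) (hmin_pos : 0 < hmin) (H : SimpleGraph (Fin k)) (n : ℕ)
    {B : Set (Fin k → ℝ)} (hB : MeasurableSet B) :
    ∫ ω, (Nat.card {f : H.Copy (modelGraph τ hmin n ω) // ω.1 ∘ f ∈ B} : ℝ)
        ∂modelMeasure τ hmin n =
      n.descFactorial k * motifProbOn τ hmin H n B := by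
  have := isProbabilityMeasure_hiddenLaw hτ hmin_pos
  have : IsProbabilityMeasure (modelMeasure τ hmin n) := by
    unfold modelMeasure
    infer_instance
  have hm := measurableSet_copyEvent τ hmin H (n := n) hB
  simp only [card_copy_eq_sum]
  rw [integral_finsetSum _ fun f _ ↦ (integrable_indicator_iff (hm f)).2
    (integrableOn_const (measure_ne_top _ _))]
  simp [integral_indicator_one (hm _), modelMeasure_real_copyEvent hτ hmin_pos H hB,
    Fintype.card_embedding_eq]

lemma expCount_eq (hτ : 1 < τ) (hmin_pos : 0 < hmin) (H : SimpleGraph (Fin k)) (n : ℕ) :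
    expCount τ hmin H n = n.descFactorial k * motifProb τ hmin H n := by
  classical
  rw [← motifProbOn_univ, ← integral_card_copy hτ hmin_pos H n MeasurableSet.univ, expCount]
  refine integral_congr_ae (.of_forall fun ω ↦ ?_)
  simp only [SimpleGraph.labelledCopyCount, Set.mem_univ]
  rw [Nat.card_congr (Equiv.subtypeUnivEquiv fun _ ↦ trivial), Nat.card_eq_fintype_card]
  congr!

/-- The hidden variables allowed by the window of width `ε` around the profile `α`. -/
def window (α : Fin k → ℝ) (ε : ℝ) (n : ℕ) : Set (Fin k → ℝ) :=
  Set.univ.pi fun i ↦ Set.Icc (ε * (n : ℝ) ^ α i) (1 / ε * (n : ℝ) ^ α i)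

lemma measurableSet_window (α : Fin k → ℝ) (ε : ℝ) (n : ℕ) : MeasurableSet (window α ε n) :=
  MeasurableSet.univ_pi fun _ ↦ measurableSet_Icc

lemma window_anti (α : Fin k → ℝ) {ε ε' : ℝ} (hε : 0 < ε) (hle : ε ≤ ε') (n : ℕ) :
    window α ε' n ⊆ window α ε n :=
  Set.pi_mono fun i _ ↦ Set.Icc_subset_Icc (by gcongr) (by gcongr)

lemma expWindowCount_eq (hτ : 1 < τ) (hmin_pos : 0 < hmin) (H : SimpleGraph (Fin k))
    (α : Fin k → ℝ) (ε : ℝ) (n : ℕ) :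
    expWindowCount τ hmin H α ε n = n.descFactorial k * motifProbOn τ hmin H n (window α ε n) := by
  rw [← integral_card_copy hτ hmin_pos H n (measurableSet_window α ε n), expWindowCount]
  simp only [windowCount, window, Set.mem_univ_pi, Function.comp_apply]

end Model

/-! ### Decay away from the optimal profile -/

section LogCoordinates

variable {τ hmin : ℝ} {k : ℕ}

/-- The logarithm of a hidden variable relative to the scale `√(μ n)`. -/
def logCoord (τ hmin : ℝ) (n : ℕ) (x : ℝ) : ℝ :=
  Real.log x - Real.log (meanHidden τ hmin * n) / 2

/-- The distance, in the logarithmic scale, of the hidden variables `h` to the profile `α`. -/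
def logDist (α : Fin k → ℝ) (n : ℕ) (h : Fin k → ℝ) : ℝ :=
  ∑ i, |Real.log (h i) - α i * Real.log n|

lemma logDist_nonneg (α : Fin k → ℝ) (n : ℕ) (h : Fin k → ℝ) : 0 ≤ logDist α n h :=
  Finset.sum_nonneg fun _ _ ↦ abs_nonneg _

lemma abs_log_sub_le_logDist (α : Fin k → ℝ) (n : ℕ) (h : Fin k → ℝ) (i : Fin k) :
    |Real.log (h i) - α i * Real.log n| ≤ logDist α n h :=
  Finset.single_le_sum (f := fun i ↦ |Real.log (h i) - α i * Real.log n|)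
    (fun _ _ ↦ abs_nonneg _) (Finset.mem_univ i)

/-- The exponent of `n` in the order of the edge product at the profile of a partition. -/
def edgeExponent (H : SimpleGraph (Fin k)) (P : VertexPartition k) : ℝ :=
  cappedEdgeSum H (fun i ↦ (P i).sign) / 2

lemma Bf_eq {H : SimpleGraph (Fin k)} {P : VertexPartition k} (hP : IsOptimal τ H P) :
    Bf τ H = objective τ H P := by
  have : Nonempty (VertexPartition k) := ⟨P⟩
  exact le_antisymm (ciSup_le hP) (le_ciSup ⟨_, Set.forall_mem_range.2 hP⟩ P)

lemma growthExponent_sub_eq (hτ : τ ≠ 1) {H : SimpleGraph (Fin k)} {P : VertexPartition k}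
    (hP : IsOptimal τ H P) :
    growthExponent τ H - k = edgeExponent H P + -(τ - 1) * ∑ i, profile P i := by
  have hsum : ∑ i, profile P i = k / 2 + (∑ i, (P i).sign) / 2 := by
    simp only [profile, Part.exponent_eq, Finset.sum_add_distrib, Finset.sum_div]
    simp [div_eq_mul_inv]
  have hobj := logWeight_sign hτ H P
  rw [logWeight] at hobj
  rw [growthExponent, Bf_eq hP, edgeExponent, hsum]
  linarith

lemma connProb_eq_exp (hτ : 2 < τ) (hmin_pos : 0 < hmin) {n : ℕ} (hn : 0 < n) {x y : ℝ}
    (hx : 0 < x) (hy : 0 < y) : connProb τ hmin n x y =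
      Real.exp (min (logCoord τ hmin n x + logCoord τ hmin n y) 0) := by
  have hμn : 0 < meanHidden τ hmin * n := mul_pos (meanHidden_pos hτ hmin_pos) (Nat.cast_pos.2 hn)
  have hsum : logCoord τ hmin n x + logCoord τ hmin n y =
      Real.log x + Real.log y - Real.log (meanHidden τ hmin * n) := by
    unfold logCoord
    ring
  rw [connProb, Real.exp_monotone.map_min, Real.exp_zero, hsum, Real.exp_sub, Real.exp_add,
    Real.exp_log hx, Real.exp_log hy, Real.exp_log hμn]

lemma edgeProd_eq_exp (hτ : 2 < τ) (hmin_pos : 0 < hmin) (H : SimpleGraph (Fin k)) {n : ℕ}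
    (hn : 0 < n) {h : Fin k → ℝ} (hh : ∀ i, 0 < h i) :
    edgeProd τ hmin H n h = Real.exp (cappedEdgeSum H fun i ↦ logCoord τ hmin n (h i)) := by
  rw [cappedEdgeSum, Real.exp_sum, edgeProd]
  exact Finset.prod_congr rfl fun q _ ↦ connProb_eq_exp hτ hmin_pos hn (hh _) (hh _)

lemma logCoord_eq (hτ : 2 < τ) (hmin_pos : 0 < hmin) {n : ℕ} (hn : 0 < n) (s : Part) (x : ℝ) :
    logCoord τ hmin n x = Real.log n / 2 * s.sign +
      (Real.log x - s.exponent * Real.log n - Real.log (meanHidden τ hmin) / 2) := by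
  rw [logCoord, Real.log_mul (meanHidden_pos hτ hmin_pos).ne' (Nat.cast_ne_zero.2 hn.ne'),
    Part.exponent_eq]
  ring

end LogCoordinates

section UpperBound

variable {τ hmin : ℝ} {k : ℕ} {H : SimpleGraph (Fin k)} {P : VertexPartition k}

/-- The lower cutoff `hmin` keeps the log-coordinates above `-L` with `L = log n / 2 + O(1)`, so
that the linear loss around the optimal partition applies. -/
lemma exists_cappedEdgeSum_logCoord_le (hτ : 2 < τ) (hmin_pos : 0 < hmin)
    (hP : IsUniqueOptimal τ H P) :
    ∃ c > 0, ∃ C, ∀ᶠ n : ℕ in atTop, ∀ h : Fin k → ℝ, (∀ i, hmin < h i) →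
      cappedEdgeSum H (fun i ↦ logCoord τ hmin n (h i)) ≤
        C + Real.log n * edgeExponent H P +
          (τ - 1) * ∑ i, (Real.log (h i) - profile P i * Real.log n) -
            c * logDist (profile P) n h := by
  obtain ⟨c, hc, hle⟩ := exists_logWeight_le (by linarith) hP
  set m := Real.log (meanHidden τ hmin)
  set L₀ := m / 2 - Real.log hmin with hL₀
  set b : Fin k → ℝ := fun i ↦ m / 2 + L₀ * (P i).sign
  refine ⟨c, hc, 2 * L₀ * edgeExponent H P + (c * ∑ i, |b i| - (τ - 1) * ∑ i, b i), ?_⟩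
  have hL : ∀ᶠ n : ℕ in atTop, 0 ≤ Real.log n / 2 + L₀ :=
    (tendsto_atTop_add_const_right _ L₀ <|
      (Real.tendsto_log_atTop.comp tendsto_natCast_atTop_atTop).atTop_div_const
        two_pos).eventually_ge_atTop 0
  filter_upwards [hL, eventually_gt_atTop 0] with n hL hn h hh
  set d : Fin k → ℝ := fun i ↦ Real.log (h i) - profile P i * Real.log n
  set y : Fin k → ℝ := fun i ↦ logCoord τ hmin n (h i)
  have hy (i : Fin k) : y i - (Real.log n / 2 + L₀) * (P i).sign = d i - b i := by
    simp only [y, logCoord_eq hτ hmin_pos hn (P i), d, b, profile]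
    ring
  have hyL (i : Fin k) : -(Real.log n / 2 + L₀) ≤ y i := by
    have := Real.log_le_log hmin_pos (hh i).le
    simp only [y, logCoord_eq hτ hmin_pos hn .S3, Part.sign, Part.exponent, hL₀]
    linarith
  have hdist : logDist (profile P) n h - ∑ i, |b i| ≤ ∑ i, |d i - b i| := by
    rw [logDist, ← Finset.sum_sub_distrib]
    exact Finset.sum_le_sum fun i _ ↦ abs_sub_abs_le_abs_sub _ _
  have hsum : ∑ i, y i = (Real.log n / 2 + L₀) * ∑ i, (P i).sign + (∑ i, d i - ∑ i, b i) := by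
    rw [Finset.mul_sum, ← Finset.sum_sub_distrib, ← Finset.sum_add_distrib]
    exact Finset.sum_congr rfl fun i _ ↦ by linarith [hy i]
  have hbound := hle _ hL y hyL
  simp only [hy, logWeight, hsum] at hbound
  have := mul_le_mul_of_nonneg_left hdist hc.le
  rw [edgeExponent]
  linarith

lemma exists_edgeProd_le (hτ : 2 < τ) (hmin_pos : 0 < hmin) (hP : IsUniqueOptimal τ H P) :
    ∃ a > 0, ∃ K > 0, ∀ᶠ n : ℕ in atTop, ∀ h : Fin k → ℝ, (∀ i, hmin < h i) →
      edgeProd τ hmin H n h ≤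
        K * n ^ edgeExponent H P * Real.exp (-a * logDist (profile P) n h) *
          ∏ i, scaleWeight (τ - 1) a (profile P i * Real.log n) (h i) := by
  obtain ⟨c, hc, C, hle⟩ := exists_cappedEdgeSum_logCoord_le hτ hmin_pos hP
  refine ⟨c / 2, by positivity, Real.exp C, Real.exp_pos C, ?_⟩
  filter_upwards [hle, eventually_gt_atTop 0] with n hle hn h hh
  rw [edgeProd_eq_exp hτ hmin_pos H hn fun i ↦ hmin_pos.trans (hh i),
    Real.rpow_def_of_pos (Nat.cast_pos.2 hn)]
  simp only [scaleWeight]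
  rw [← Real.exp_sum, ← Real.exp_add, ← Real.exp_add, ← Real.exp_add, Real.exp_le_exp,
    Finset.sum_sub_distrib, ← Finset.mul_sum, ← Finset.mul_sum]
  refine (hle h hh).trans_eq ?_
  rw [logDist]
  ring

lemma integral_prod_scaleWeight_le (hτ : 1 < τ) (hmin_pos : 0 < hmin) {a : ℝ} (ha : 0 < a)
    (α : Fin k → ℝ) {n : ℕ} (hn : 0 < n) :
    ∫ h, ∏ i, scaleWeight (τ - 1) a (α i * Real.log n) (h i) ∂hiddenLawPi τ hmin k ≤
      ((τ - 1) * hmin ^ (τ - 1) * (2 / a)) ^ k * n ^ (-(τ - 1) * ∑ i, α i) := by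
  have := isProbabilityMeasure_hiddenLaw hτ hmin_pos
  rw [integral_fintype_prod_eq_prod]
  refine (Finset.prod_le_prod (fun i _ ↦ integral_nonneg fun x ↦ (Real.exp_pos _).le)
    fun i _ ↦ integral_scaleWeight_le hmin_pos (sub_pos.2 hτ) ha _).trans_eq ?_
  simp only [mul_left_comm _ (Real.exp _), Finset.prod_mul_distrib, Finset.prod_const,
    Finset.card_univ, Fintype.card_fin]
  rw [← Real.exp_sum, Real.rpow_def_of_pos (Nat.cast_pos.2 hn), ← Finset.mul_sum,
    ← Finset.sum_mul]
  simp only [mul_pow]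
  ring_nf

theorem exists_motifProbOn_le (hτ : 2 < τ) (hmin_pos : 0 < hmin) (hP : IsUniqueOptimal τ H P) :
    ∃ a > 0, ∃ K > 0, ∀ᶠ n : ℕ in atTop, ∀ (r : ℝ) (B : Set (Fin k → ℝ)), MeasurableSet B →
      (∀ h ∈ B, (∀ i, hmin < h i) → r ≤ logDist (profile P) n h) →
        motifProbOn τ hmin H n B ≤
          K * Real.exp (-a * r) * n ^ (growthExponent τ H - k) := by
  obtain ⟨a, ha, K, hK, hle⟩ := exists_edgeProd_le hτ hmin_pos hP
  have hτ1 : 1 < τ := by linarith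
  have := sub_pos.2 hτ1
  have := isProbabilityMeasure_hiddenLaw hτ1 hmin_pos
  refine ⟨a, ha, K * ((τ - 1) * hmin ^ (τ - 1) * (2 / a)) ^ k, by positivity, ?_⟩
  filter_upwards [hle, eventually_gt_atTop 0] with n hle hn r B hB hBr
  set G : (Fin k → ℝ) → ℝ := fun h ↦
    ∏ i, scaleWeight (τ - 1) a (profile P i * Real.log n) (h i)
  have hG0 (h : Fin k → ℝ) : 0 ≤ G h := Finset.prod_nonneg fun i _ ↦ (Real.exp_pos _).le
  have hGint : Integrable G (hiddenLawPi τ hmin k) :=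
    Integrable.fintype_prod fun i ↦ integrable_scaleWeight hmin_pos (sub_pos.2 hτ1) ha _
  set D := K * n ^ edgeExponent H P * Real.exp (-a * r) with hD
  have hD0 : 0 ≤ D := by positivity
  calc motifProbOn τ hmin H n B
      ≤ ∫ h in B, D * G h ∂hiddenLawPi τ hmin k := by
        refine integral_mono_ae (integrable_edgeProd hτ1 hmin_pos H n).integrableOn
          (hGint.const_mul _).integrableOn ?_
        filter_upwards [ae_restrict_mem hB,
          ae_restrict_of_ae (ae_lt_hiddenLawPi hτ1 hmin_pos k)] with h hhB hh
        have hr := hBr h hhB hh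
        refine (hle h hh).trans (mul_le_mul_of_nonneg_right ?_ (hG0 h))
        exact mul_le_mul_of_nonneg_left
          (Real.exp_le_exp.2 (mul_le_mul_of_nonpos_left hr (neg_nonpos.2 ha.le))) (by positivity)
    _ ≤ D * ∫ h, G h ∂hiddenLawPi τ hmin k := by
        rw [integral_const_mul]
        exact mul_le_mul_of_nonneg_left (setIntegral_le_integral hGint (.of_forall hG0)) hD0
    _ ≤ D * (((τ - 1) * hmin ^ (τ - 1) * (2 / a)) ^ k * n ^ (-(τ - 1) * ∑ i, profile P i)) :=
        mul_le_mul_of_nonneg_left (integral_prod_scaleWeight_le hτ1 hmin_pos ha _ hn) hD0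
    _ = _ := by
        rw [growthExponent_sub_eq hτ1.ne' hP.isOptimal, Real.rpow_add (Nat.cast_pos.2 hn), hD]
        ring

end UpperBound

/-! ### The windows of the optimal profile -/

section Window

variable {τ hmin : ℝ} {k : ℕ}

lemma cappedEdgeSum_const_mul (H : SimpleGraph (Fin k)) {L : ℝ} (hL : 0 ≤ L) (y : Fin k → ℝ) :
    cappedEdgeSum H (fun i ↦ L * y i) = L * cappedEdgeSum H y := by
  simp only [cappedEdgeSum, Finset.mul_sum, mul_min_of_nonneg _ _ hL, mul_add, mul_zero]

lemma abs_cappedEdgeSum_sub_le (H : SimpleGraph (Fin k)) {y z : Fin k → ℝ} {r : ℝ}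
    (hyz : ∀ i, |y i - z i| ≤ r) :
    |cappedEdgeSum H y - cappedEdgeSum H z| ≤ (edgePairs H).card * (r + r) := by
  rw [cappedEdgeSum, cappedEdgeSum, ← Finset.sum_sub_distrib, ← nsmul_eq_mul]
  refine (Finset.abs_sum_le_sum_abs _ _).trans (Finset.sum_le_card_nsmul _ _ _ fun q _ ↦ ?_)
  refine (abs_min_sub_min_le_max _ _ _ _).trans (max_le ?_ ?_)
  · rw [add_sub_add_comm]
    exact (abs_add_le _ _).trans (add_le_add (hyz _) (hyz _))
  · have := (abs_nonneg _).trans (hyz q.1)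
    simpa using this

lemma mem_Icc_rpow_iff {n : ℕ} (hn : 0 < n) {ε a x : ℝ} (hε : 0 < ε) (hx : 0 < x) :
    x ∈ Set.Icc (ε * (n : ℝ) ^ a) (1 / ε * (n : ℝ) ^ a) ↔
      |Real.log x - a * Real.log n| ≤ -Real.log ε := by
  have hn' : (0 : ℝ) < n := Nat.cast_pos.2 hn
  rw [Set.mem_Icc, ← Real.log_le_log_iff (by positivity) hx,
    ← Real.log_le_log_iff hx (by positivity), Real.log_mul hε.ne' (by positivity),
    Real.log_mul (by positivity) (by positivity), Real.log_rpow hn', one_div, Real.log_inv, abs_le,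
    neg_neg, le_sub_iff_add_le, sub_le_iff_le_add]

lemma pos_of_mem_window {α : Fin k → ℝ} {ε : ℝ} (hε : 0 < ε) {n : ℕ} (hn : 0 < n)
    {h : Fin k → ℝ} (hh : h ∈ window α ε n) (i : Fin k) : 0 < h i :=
  (by positivity : 0 < ε * (n : ℝ) ^ α i).trans_le (Set.mem_univ_pi.1 hh i).1

lemma abs_log_sub_le_of_mem_window {α : Fin k → ℝ} {ε : ℝ} (hε : 0 < ε) {n : ℕ} (hn : 0 < n)
    {h : Fin k → ℝ} (hh : h ∈ window α ε n) (i : Fin k) :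
    |Real.log (h i) - α i * Real.log n| ≤ -Real.log ε :=
  (mem_Icc_rpow_iff hn hε (pos_of_mem_window hε hn hh i)).1 (Set.mem_univ_pi.1 hh i)

lemma exists_edgeProd_window_bounds (hτ : 2 < τ) (hmin_pos : 0 < hmin) (H : SimpleGraph (Fin k))
    (P : VertexPartition k) {ε : ℝ} (hε : 0 < ε) :
    ∃ M > 0, ∀ n > 0, ∀ h ∈ window (profile P) ε n,
      M⁻¹ * (n : ℝ) ^ edgeExponent H P ≤ edgeProd τ hmin H n h ∧
        edgeProd τ hmin H n h ≤ M * (n : ℝ) ^ edgeExponent H P := by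
  set r := -Real.log ε + |Real.log (meanHidden τ hmin) / 2|
  refine ⟨Real.exp ((edgePairs H).card * (r + r)), Real.exp_pos _, fun n hn h hh ↦ ?_⟩
  have hclose (i : Fin k) : |logCoord τ hmin n (h i) - Real.log n / 2 * (P i).sign| ≤ r := by
    rw [logCoord_eq hτ hmin_pos hn (P i), add_sub_cancel_left]
    exact (abs_sub _ _).trans
      (add_le_add_left (abs_log_sub_le_of_mem_window hε hn hh i) _)
  have hsum := abs_cappedEdgeSum_sub_le H hclose
  have hlog : 0 ≤ Real.log n / 2 := div_nonneg (Real.log_natCast_nonneg n) two_pos.le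
  rw [cappedEdgeSum_const_mul H hlog, abs_le] at hsum
  rw [edgeProd_eq_exp hτ hmin_pos H hn (pos_of_mem_window hε hn hh),
    Real.rpow_def_of_pos (Nat.cast_pos.2 hn), ← Real.exp_neg, ← Real.exp_add, ← Real.exp_add,
    Real.exp_le_exp, Real.exp_le_exp, edgeExponent]
  constructor <;> linarith

/-- The rescaled mass of the window of width `ε` in the class `s`. -/
def classWeight (τ hmin ε : ℝ) : Part → ℝ
  | .S1 => (hiddenLaw τ hmin).real (Set.Icc ε (1 / ε))
  | _ => hmin ^ (τ - 1) * (ε ^ (-(τ - 1)) - (1 / ε) ^ (-(τ - 1)))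

lemma classWeight_pos (hτ : 1 < τ) (hmin_pos : 0 < hmin) {P : VertexPartition k} {ε : ℝ}
    (hε : Admissible hmin P ε) (i : Fin k) : 0 < classWeight τ hmin ε (P i) := by
  obtain ⟨hε0, hε1, hS1⟩ := hε
  have hlt : ε < 1 / ε := hε1.trans (one_lt_one_div hε0 hε1)
  have hpos {a b : ℝ} (ha : 0 < a) (hab : a < b) :
      0 < hmin ^ (τ - 1) * (a ^ (-(τ - 1)) - b ^ (-(τ - 1))) :=
    mul_pos (by positivity) (sub_pos.2 (Real.rpow_lt_rpow_of_neg ha hab (by linarith)))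
  rcases hi : P i with _ | _ | _
  · have := isProbabilityMeasure_hiddenLaw hτ hmin_pos
    obtain ⟨a, ha, hab⟩ := exists_between (max_lt hlt (hS1 ⟨i, hi⟩))
    obtain ⟨hεa, hmina⟩ := max_lt_iff.1 ha
    refine lt_of_lt_of_le ?_ (measureReal_mono (Set.Icc_subset_Icc_left hεa.le))
    rw [hiddenLaw, paretoMeasure_real_Icc hmin_pos (sub_pos.2 hτ) hmina hab.le]
    exact hpos (hε0.trans hεa) hab
  · exact hpos hε0 hlt
  · exact hpos hε0 hlt

lemma eventually_hiddenLaw_real_Icc (hτ : 1 < τ) (hmin_pos : 0 < hmin) {ε : ℝ} (hε0 : 0 < ε)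
    (hε1 : ε < 1) (s : Part) : ∀ᶠ n : ℕ in atTop,
      (hiddenLaw τ hmin).real
          (Set.Icc (ε * (n : ℝ) ^ s.exponent) (1 / ε * (n : ℝ) ^ s.exponent)) =
        (n : ℝ) ^ (-(τ - 1) * s.exponent) * classWeight τ hmin ε s := by
  have hscale (hs : 0 < s.exponent) : ∀ᶠ n : ℕ in atTop, (hiddenLaw τ hmin).real
      (Set.Icc (ε * (n : ℝ) ^ s.exponent) (1 / ε * (n : ℝ) ^ s.exponent)) =
        (n : ℝ) ^ (-(τ - 1) * s.exponent) *
          (hmin ^ (τ - 1) * (ε ^ (-(τ - 1)) - (1 / ε) ^ (-(τ - 1)))) := by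
    have hlim : Tendsto (fun n : ℕ ↦ ε * (n : ℝ) ^ s.exponent) atTop atTop :=
      ((tendsto_rpow_atTop hs).comp tendsto_natCast_atTop_atTop).const_mul_atTop hε0
    filter_upwards [hlim.eventually_gt_atTop hmin] with n hn
    have hle : ε ≤ 1 / ε := (hε1.trans (one_lt_one_div hε0 hε1)).le
    rw [hiddenLaw, paretoMeasure_real_Icc hmin_pos (sub_pos.2 hτ) hn (by gcongr),
      Real.mul_rpow hε0.le (by positivity), Real.mul_rpow (by positivity) (by positivity),
      ← Real.rpow_mul (Nat.cast_nonneg n), mul_comm s.exponent]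
    ring
  cases s
  · exact .of_forall fun n ↦ by simp [Part.exponent, classWeight]
  · exact hscale (by norm_num [Part.exponent])
  · exact hscale (by norm_num [Part.exponent])

/-- The rescaled mass of the window of width `ε` around the profile of `P`. -/
def windowWeight (τ hmin : ℝ) (P : VertexPartition k) (ε : ℝ) : ℝ :=
  ∏ i, classWeight τ hmin ε (P i)

lemma windowWeight_pos (hτ : 1 < τ) (hmin_pos : 0 < hmin) {P : VertexPartition k} {ε : ℝ}
    (hε : Admissible hmin P ε) : 0 < windowWeight τ hmin P ε :=
  Finset.prod_pos fun i _ ↦ classWeight_pos hτ hmin_pos hε i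

lemma eventually_hiddenLawPi_real_window (hτ : 1 < τ) (hmin_pos : 0 < hmin)
    (P : VertexPartition k) {ε : ℝ} (hε0 : 0 < ε) (hε1 : ε < 1) : ∀ᶠ n : ℕ in atTop,
      (hiddenLawPi τ hmin k).real (window (profile P) ε n) =
        (n : ℝ) ^ (-(τ - 1) * ∑ i, profile P i) * windowWeight τ hmin P ε := by
  have := isProbabilityMeasure_hiddenLaw hτ hmin_pos
  filter_upwards [eventually_all.2 fun i ↦ eventually_hiddenLaw_real_Icc hτ hmin_pos hε0 hε1 (P i),
    eventually_gt_atTop 0] with n hmass hn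
  rw [measureReal_def, window, Measure.pi_pi, ENNReal.toReal_prod, windowWeight, Finset.mul_sum,
    Real.rpow_sum_of_pos (Nat.cast_pos.2 hn), ← Finset.prod_mul_distrib]
  exact Finset.prod_congr rfl fun i _ ↦ hmass i

lemma exists_admissible (hmin_pos : 0 < hmin) (P : VertexPartition k) :
    ∃ ε, Admissible hmin P ε := by
  refine ⟨1 / (hmin + 2), by positivity, ?_, fun _ ↦ by rw [one_div_one_div]; linarith⟩
  rw [div_lt_one (by positivity)]
  linarith

variable {H : SimpleGraph (Fin k)} {P : VertexPartition k}

lemma exists_motifProbOn_window_bounds (hτ : 2 < τ) (hmin_pos : 0 < hmin)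
    (hP : IsOptimal τ H P) {ε₁ : ℝ} (hε₁ : 0 < ε₁) :
    ∃ M > 0, ∀ ε, ε₁ ≤ ε → ε < 1 → ∀ᶠ n : ℕ in atTop,
      M⁻¹ * windowWeight τ hmin P ε * (n : ℝ) ^ (growthExponent τ H - k) ≤
          motifProbOn τ hmin H n (window (profile P) ε n) ∧
        motifProbOn τ hmin H n (window (profile P) ε n) ≤
          M * windowWeight τ hmin P ε * (n : ℝ) ^ (growthExponent τ H - k) := by
  obtain ⟨M, hM, hbounds⟩ := exists_edgeProd_window_bounds hτ hmin_pos H P hε₁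
  have hτ1 : 1 < τ := by linarith
  have := isProbabilityMeasure_hiddenLaw hτ1 hmin_pos
  refine ⟨M, hM, fun ε hle hε1 ↦ ?_⟩
  filter_upwards [eventually_hiddenLawPi_real_window hτ1 hmin_pos P (hε₁.trans_le hle) hε1,
    eventually_gt_atTop 0] with n hmass hn
  have hm := measurableSet_window (profile P) ε n
  have hsub := window_anti (profile P) hε₁ hle n
  have hint := (integrable_edgeProd hτ1 hmin_pos H n).integrableOn (s := window (profile P) ε n)
  have hconst (D : ℝ) : D * windowWeight τ hmin P ε * (n : ℝ) ^ (growthExponent τ H - k) =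
      ∫ _ in window (profile P) ε n, D * (n : ℝ) ^ edgeExponent H P ∂hiddenLawPi τ hmin k := by
    rw [setIntegral_const, hmass, growthExponent_sub_eq hτ1.ne' hP,
      Real.rpow_add (Nat.cast_pos.2 hn), smul_eq_mul]
    ring
  rw [hconst, hconst, motifProbOn]
  exact ⟨setIntegral_mono_on (integrable_const _).integrableOn hint hm
      fun h hh ↦ (hbounds n hn h (hsub hh)).1,
    setIntegral_mono_on hint (integrable_const _).integrableOn hm
      fun h hh ↦ (hbounds n hn h (hsub hh)).2⟩

lemma exists_motifProb_le (hτ : 2 < τ) (hmin_pos : 0 < hmin) (hP : IsUniqueOptimal τ H P) :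
    ∃ K, ∀ᶠ n : ℕ in atTop,
      motifProb τ hmin H n ≤ K * (n : ℝ) ^ (growthExponent τ H - k) := by
  obtain ⟨a, -, K, -, hle⟩ := exists_motifProbOn_le hτ hmin_pos hP
  refine ⟨K, hle.mono fun n hn ↦ ?_⟩
  simpa [motifProbOn_univ] using
    hn 0 Set.univ MeasurableSet.univ fun h _ _ ↦ logDist_nonneg (profile P) n h

/-- Below a fixed admissible width `ε₁` the window probability is of the order of the whole
motif probability, which is why the factor `windowWeight` is frozen at `ε₁` there. -/
theorem exists_motifProbOn_window_order (hτ : 2 < τ) (hmin_pos : 0 < hmin)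
    (hP : IsUniqueOptimal τ H P) :
    ∃ (f : ℝ → ℝ) (c C : ℝ), 0 < c ∧ 0 < C ∧ ∀ ε : ℝ, Admissible hmin P ε → 0 < f ε ∧
      ∀ᶠ n : ℕ in atTop,
        c * f ε * (n : ℝ) ^ (growthExponent τ H - k) ≤
          motifProbOn τ hmin H n (window (profile P) ε n) ∧
        motifProbOn τ hmin H n (window (profile P) ε n) ≤
          C * f ε * (n : ℝ) ^ (growthExponent τ H - k) := by
  have hτ1 : 1 < τ := by linarith
  obtain ⟨ε₁, hε₁⟩ := exists_admissible hmin_pos P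
  obtain ⟨M, hM, hbounds⟩ := exists_motifProbOn_window_bounds hτ hmin_pos hP.isOptimal hε₁.1
  obtain ⟨K, htotal⟩ := exists_motifProb_le hτ hmin_pos hP
  have hw₁ := windowWeight_pos hτ1 hmin_pos hε₁
  refine ⟨fun ε ↦ windowWeight τ hmin P (max ε ε₁), M⁻¹,
    max M (K / windowWeight τ hmin P ε₁), by positivity, by positivity, fun ε hε ↦ ?_⟩
  have hmax : Admissible hmin P (max ε ε₁) := by
    rcases max_choice ε ε₁ with h | h <;> rwa [h]
  have hw := windowWeight_pos hτ1 hmin_pos hmax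
  refine ⟨hw, ?_⟩
  filter_upwards [hbounds _ (le_max_right ε ε₁) hmax.2.1, htotal] with n hn htot
  have hsub := window_anti (profile P) hε.1 (le_max_left ε ε₁) n
  refine ⟨hn.1.trans (motifProbOn_mono hτ1 hmin_pos H n hsub), ?_⟩
  obtain hle | hlt := le_or_gt ε₁ ε
  · simp only [max_eq_left hle] at hn hw ⊢
    exact hn.2.trans (by gcongr; exact le_max_left _ _)
  · simp only [max_eq_right hlt.le]
    calc motifProbOn τ hmin H n (window (profile P) ε n)
        ≤ motifProb τ hmin H n :=
          motifProbOn_le_motifProb hτ1 hmin_pos H n _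
      _ ≤ K / windowWeight τ hmin P ε₁ * windowWeight τ hmin P ε₁ *
            (n : ℝ) ^ (growthExponent τ H - k) := by rwa [div_mul_cancel₀ _ hw₁.ne']
      _ ≤ _ := by gcongr; exact le_max_right _ _

end Window

/-! ### Asymptotics of the expected counts -/

section Asymptotics

variable {τ hmin : ℝ} {k : ℕ} {H : SimpleGraph (Fin k)} {P : VertexPartition k}

theorem expCount_isEquivalent (hτ : 1 < τ) (hmin_pos : 0 < hmin) (H : SimpleGraph (Fin k)) :
    expCount τ hmin H ~[atTop] fun n : ℕ ↦ (n : ℝ) ^ k * motifProb τ hmin H n :=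
  ((isEquivalent_descFactorial k).mul (.refl (u := motifProb τ hmin H))).congr_left <|
    .of_forall fun n ↦ (expCount_eq hτ hmin_pos H n).symm

lemma rpow_isBigO_motifProbOn_window (hτ : 2 < τ) (hmin_pos : 0 < hmin)
    (hP : IsUniqueOptimal τ H P) {ε : ℝ} (hε : Admissible hmin P ε) :
    (fun n : ℕ ↦ (n : ℝ) ^ (growthExponent τ H - k)) =O[atTop]
      fun n ↦ motifProbOn τ hmin H n (window (profile P) ε n) := by
  obtain ⟨f, c, C, hc, -, hbounds⟩ := exists_motifProbOn_window_order hτ hmin_pos hP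
  obtain ⟨hf, hev⟩ := hbounds ε hε
  refine .of_bound (c * f ε)⁻¹ (hev.mono fun n hn ↦ ?_)
  rw [Real.norm_of_nonneg (by positivity), le_inv_mul_iff₀ (by positivity)]
  exact hn.1.trans (le_abs_self _)

lemma motifProb_isTheta (hτ : 2 < τ) (hmin_pos : 0 < hmin) (hP : IsUniqueOptimal τ H P) :
    motifProb τ hmin H =Θ[atTop] fun n : ℕ ↦ (n : ℝ) ^ (growthExponent τ H - k) := by
  have hτ1 : 1 < τ := by linarith
  obtain ⟨K, hK⟩ := exists_motifProb_le hτ hmin_pos hP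
  obtain ⟨ε, hε⟩ := exists_admissible hmin_pos P
  refine ⟨.of_bound K (hK.mono fun n hn ↦ ?_),
    (rpow_isBigO_motifProbOn_window hτ hmin_pos hP hε).trans (.of_norm_le fun n ↦ ?_)⟩
  · rw [Real.norm_of_nonneg (by positivity : (0 : ℝ) ≤ n ^ (growthExponent τ H - k)),
      Real.norm_of_nonneg (motifProb_nonneg hτ1 hmin_pos H n)]
    exact hn
  · rw [Real.norm_of_nonneg (motifProbOn_nonneg hτ1 hmin_pos H n _)]
    exact motifProbOn_le_motifProb hτ1 hmin_pos H n _

lemma pow_mul_rpow_sub {n : ℕ} (hn : 0 < n) (k : ℕ) (e : ℝ) :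
    (n : ℝ) ^ k * (n : ℝ) ^ (e - k) = (n : ℝ) ^ e := by
  rw [← Real.rpow_natCast, ← Real.rpow_add (Nat.cast_pos.2 hn), add_sub_cancel]

theorem expCount_isTheta (hτ : 2 < τ) (hmin_pos : 0 < hmin) (hP : IsUniqueOptimal τ H P) :
    expCount τ hmin H =Θ[atTop] fun n : ℕ ↦ (n : ℝ) ^ growthExponent τ H :=
  (expCount_isEquivalent (by linarith) hmin_pos H).isTheta.trans <|
    ((isTheta_refl _ _).mul (motifProb_isTheta hτ hmin_pos hP)).trans_eventuallyEq <|
      (eventually_gt_atTop 0).mono fun _ hn ↦ pow_mul_rpow_sub hn k _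

lemma eventually_descFactorial_div_pow_mem_Icc (k : ℕ) :
    ∀ᶠ n : ℕ in atTop, (n.descFactorial k : ℝ) / (n : ℝ) ^ k ∈ Set.Icc (1 / 2) 1 := by
  have hlim : Tendsto (fun n : ℕ ↦ (n.descFactorial k : ℝ) / (n : ℝ) ^ k) atTop (nhds 1) :=
    (isEquivalent_iff_tendsto_one ((eventually_gt_atTop 0).mono fun n hn ↦ by positivity)).1
      (isEquivalent_descFactorial k)
  filter_upwards [hlim.eventually_const_le one_half_lt_one] with n hn
  exact ⟨hn, div_le_one_of_le₀ (mod_cast n.descFactorial_le_pow k) (by positivity)⟩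

theorem exists_expWindowCount_bounds (hτ : 2 < τ) (hmin_pos : 0 < hmin)
    (hP : IsUniqueOptimal τ H P) :
    ∃ (f : ℝ → ℝ) (c C : ℝ), 0 < c ∧ 0 < C ∧ ∀ ε : ℝ, Admissible hmin P ε → 0 < f ε ∧
      ∀ᶠ n : ℕ in atTop,
        c * f ε ≤ expWindowCount τ hmin H (profile P) ε n / (n : ℝ) ^ growthExponent τ H ∧
          expWindowCount τ hmin H (profile P) ε n / (n : ℝ) ^ growthExponent τ H ≤ C * f ε := by
  obtain ⟨f, c, C, hc, hC, hbounds⟩ := exists_motifProbOn_window_order hτ hmin_pos hP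
  refine ⟨f, 1 / 2 * c, C, by positivity, hC, fun ε hε ↦ ⟨(hbounds ε hε).1, ?_⟩⟩
  obtain ⟨hf, hev⟩ := hbounds ε hε
  filter_upwards [hev, eventually_descFactorial_div_pow_mem_Icc k, eventually_gt_atTop 0]
    with n hn hdesc hn0
  have hpow : (0 : ℝ) < (n : ℝ) ^ (growthExponent τ H - k) := by positivity
  rw [expWindowCount_eq (by linarith) hmin_pos, ← pow_mul_rpow_sub hn0 k, mul_div_mul_comm,
    mul_assoc, ← one_mul (C * f ε)]
  have hlow := (le_div_iff₀ hpow).2 hn.1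
  have hup := (div_le_iff₀ hpow).2 hn.2
  exact ⟨mul_le_mul hdesc.1 hlow (by positivity) (by positivity),
    mul_le_mul hdesc.2 hup (le_trans (by positivity) hlow) zero_le_one⟩

lemma exists_motifProbOn_window_isBigO (hτ : 2 < τ) (hmin_pos : 0 < hmin)
    (hP : IsUniqueOptimal τ H P) {α : Fin k → ℝ} (hα : α ≠ profile P) :
    ∃ η > (0 : ℝ), ∀ ε > (0 : ℝ), (fun n ↦ motifProbOn τ hmin H n (window α ε n)) =O[atTop]
      fun n : ℕ ↦ (n : ℝ) ^ (-η) * (n : ℝ) ^ (growthExponent τ H - k) := by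
  obtain ⟨a, ha, K, -, hle⟩ := exists_motifProbOn_le hτ hmin_pos hP
  obtain ⟨i, hi⟩ := Function.ne_iff.1 hα
  have hgap : 0 < |α i - profile P i| := abs_pos.2 (sub_ne_zero.2 hi)
  refine ⟨a * |α i - profile P i|, mul_pos ha hgap, fun ε hε ↦
    .of_bound (K * Real.exp (-a * Real.log ε)) ?_⟩
  filter_upwards [hle, eventually_gt_atTop 0] with n hle hn
  have hdist (h : Fin k → ℝ) (hh : h ∈ window α ε n) :
      |α i - profile P i| * Real.log n + Real.log ε ≤ logDist (profile P) n h := by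
    refine le_trans ?_ (abs_log_sub_le_logDist (profile P) n h i)
    have htri := abs_sub_le (α i * Real.log n) (Real.log (h i)) (profile P i * Real.log n)
    rw [← sub_mul, abs_mul, abs_of_nonneg (Real.log_natCast_nonneg n), abs_sub_comm (_ * _)] at htri
    linarith [abs_log_sub_le_of_mem_window hε hn hh i]
  rw [Real.norm_of_nonneg (motifProbOn_nonneg (by linarith) hmin_pos H n _),
    Real.norm_of_nonneg (by positivity), ← mul_assoc]
  refine (hle _ _ (measurableSet_window α ε n) fun h hh _ ↦ hdist h hh).trans_eq ?_
  rw [Real.rpow_def_of_pos (Nat.cast_pos.2 hn) (-_), mul_assoc K (Real.exp _) (Real.exp _),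
    ← Real.exp_add]
  ring_nf

theorem exists_expWindowCount_div_isBigO (hτ : 2 < τ) (hmin_pos : 0 < hmin)
    (hP : IsUniqueOptimal τ H P) {α : Fin k → ℝ} (hα : α ≠ profile P) :
    ∃ η : ℝ, 0 < η ∧ ∀ ε : ℝ, Admissible hmin P ε →
      (fun n : ℕ ↦ expWindowCount τ hmin H α ε n / expWindowCount τ hmin H (profile P) ε n)
        =O[atTop] fun n : ℕ ↦ (n : ℝ) ^ (-η) := by
  obtain ⟨η, hη, hnum⟩ := exists_motifProbOn_window_isBigO hτ hmin_pos hP hα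
  refine ⟨η, hη, fun ε hε ↦ ?_⟩
  have hden := (rpow_isBigO_motifProbOn_window hτ hmin_pos hP hε).inv_rev <|
    (eventually_gt_atTop 0).mono fun n hn h0 ↦ absurd h0 (by positivity)
  refine ((hnum ε hε.1).mul hden).congr' ?_ ?_
  · filter_upwards [eventually_ge_atTop k] with n hn
    have hdesc : (n.descFactorial k : ℝ) ≠ 0 :=
      Nat.cast_ne_zero.2 (mt Nat.descFactorial_eq_zero_iff_lt.1 hn.not_gt)
    rw [expWindowCount_eq (by linarith) hmin_pos, expWindowCount_eq (by linarith) hmin_pos,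
      mul_div_mul_left _ _ hdesc, div_eq_mul_inv]
  · filter_upwards [eventually_gt_atTop 0] with n hn
    exact mul_inv_cancel_right₀ (by positivity) _

lemma exists_motifProbOn_compl_window_le (hτ : 2 < τ) (hmin_pos : 0 < hmin)
    (hP : IsUniqueOptimal τ H P) :
    ∃ a > (0 : ℝ), ∃ K > (0 : ℝ), ∀ ε > (0 : ℝ), ∀ᶠ n : ℕ in atTop,
      motifProbOn τ hmin H n (window (profile P) ε n)ᶜ ≤
        K * ε ^ a * (n : ℝ) ^ (growthExponent τ H - k) := by
  obtain ⟨a, ha, K, hK, hle⟩ := exists_motifProbOn_le hτ hmin_pos hP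
  refine ⟨a, ha, K, hK, fun ε hε ↦ ?_⟩
  filter_upwards [hle, eventually_gt_atTop 0] with n hle hn
  rw [Real.rpow_def_of_pos hε, mul_comm (Real.log ε), ← neg_mul_neg a]
  refine hle _ _ (measurableSet_window (profile P) ε n).compl fun h hh hpos ↦ ?_
  by_contra! hlt
  exact hh <| Set.mem_univ_pi.2 fun i ↦ (mem_Icc_rpow_iff hn hε (hmin_pos.trans (hpos i))).2 <|
    (abs_log_sub_le_logDist (profile P) n h i).trans hlt.le

theorem exists_forall_le_expWindowCount (hτ : 2 < τ) (hmin_pos : 0 < hmin)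
    (hP : IsUniqueOptimal τ H P) {δ : ℝ} (hδ : 0 < δ) :
    ∃ ε₀ : ℝ, 0 < ε₀ ∧ ε₀ < 1 ∧ ∀ ε : ℝ, 0 < ε → ε < ε₀ → ∀ᶠ n : ℕ in atTop,
      (1 - δ) * expCount τ hmin H n ≤ expWindowCount τ hmin H (profile P) ε n := by
  have hτ1 : 1 < τ := by linarith
  obtain ⟨a, ha, K, hK, hcompl⟩ := exists_motifProbOn_compl_window_le hτ hmin_pos hP
  obtain ⟨c, hc, hlow⟩ := (motifProb_isTheta hτ hmin_pos hP).2.exists_pos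
  refine ⟨min (1 / 2) ((δ / (K * c)) ^ a⁻¹), by positivity,
    (min_le_left _ _).trans_lt one_half_lt_one, fun ε hε hlt ↦ ?_⟩
  have hεa : K * ε ^ a * c ≤ δ := by
    have := Real.rpow_le_rpow hε.le (hlt.le.trans (min_le_right _ _)) ha.le
    rw [Real.rpow_inv_rpow (by positivity) ha.ne', le_div_iff₀ (by positivity)] at this
    linarith
  filter_upwards [hcompl ε hε, hlow.bound] with n hn hlow
  have hprob := motifProb_nonneg hτ1 hmin_pos H n
  rw [Real.norm_of_nonneg (by positivity), Real.norm_of_nonneg hprob] at hlow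
  have hloss : motifProbOn τ hmin H n (window (profile P) ε n)ᶜ ≤ δ * motifProb τ hmin H n :=
    calc _ ≤ K * ε ^ a * (c * motifProb τ hmin H n) := hn.trans (by gcongr)
      _ = K * ε ^ a * c * motifProb τ hmin H n := by ring
      _ ≤ δ * motifProb τ hmin H n := by gcongr
  rw [expCount_eq hτ1 hmin_pos, expWindowCount_eq hτ1 hmin_pos, mul_left_comm]
  have hsplit := motifProbOn_add_compl hτ1 hmin_pos H n (measurableSet_window (profile P) ε n)
  gcongr
  linarith

end Asymptotics

end HiddenVariable

end

open HiddenVariable in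
theorem theorem1_general (τ hmin : ℝ) (hτ : 2 < τ) (hmin_pos : 0 < hmin)
    (k : ℕ) (H : SimpleGraph (Fin k))
    (P : VertexPartition k) (hopt : IsOptimal τ H P)
    (huniq : ∀ Q : VertexPartition k, IsOptimal τ H Q → Q = P) :
    (expCount τ hmin H ~[atTop]
      fun n : ℕ => (n : ℝ) ^ k * motifProb τ hmin H n) ∧
    (expCount τ hmin H =Θ[atTop]
      fun n : ℕ => (n : ℝ) ^ growthExponent τ H) ∧
    (∃ (f : ℝ → ℝ) (c C : ℝ), 0 < c ∧ 0 < C ∧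
      ∀ ε : ℝ, Admissible hmin P ε → 0 < f ε ∧
        ∀ᶠ n : ℕ in atTop,
          c * f ε ≤ expWindowCount τ hmin H (profile P) ε n /
              (n : ℝ) ^ growthExponent τ H ∧
          expWindowCount τ hmin H (profile P) ε n /
              (n : ℝ) ^ growthExponent τ H ≤ C * f ε) ∧
    (∀ α : Fin k → ℝ, α ≠ profile P → ∃ η : ℝ, 0 < η ∧
      ∀ ε : ℝ, Admissible hmin P ε →
        (fun n : ℕ => expWindowCount τ hmin H α ε n /
            expWindowCount τ hmin H (profile P) ε n)
          =O[atTop] fun n : ℕ => (n : ℝ) ^ (-η)) ∧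
    (∀ δ : ℝ, 0 < δ → ∃ ε₀ : ℝ, 0 < ε₀ ∧ ε₀ < 1 ∧ ∀ ε : ℝ, 0 < ε → ε < ε₀ →
      ∀ᶠ n : ℕ in atTop,
        (1 - δ) * expCount τ hmin H n ≤
          expWindowCount τ hmin H (profile P) ε n) :=
  have hP := hopt.isUniqueOptimal huniq
  ⟨expCount_isEquivalent (by linarith) hmin_pos H, expCount_isTheta hτ hmin_pos hP,
    exists_expWindowCount_bounds hτ hmin_pos hP,
    fun _ hα ↦ exists_expWindowCount_div_isBigO hτ hmin_pos hP hα,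
    fun _ hδ ↦ exists_forall_le_expWindowCount hτ hmin_pos hP hδ⟩

theorem theorem1 (τ hmin : ℝ) (hτ : 2 < τ) (hτ' : τ < 3) (hmin_pos : 0 < hmin)
    (k : ℕ) (H : SimpleGraph (Fin k))
    (P : HiddenVariable.VertexPartition k) (hopt : HiddenVariable.IsOptimal τ H P)
    (huniq : ∀ Q : HiddenVariable.VertexPartition k, HiddenVariable.IsOptimal τ H Q → Q = P) :
    -- `E[N(H)] ~ n^k P(H)`
    (HiddenVariable.expCount τ hmin H ~[atTop]
      fun n : ℕ => (n : ℝ) ^ k * HiddenVariable.motifProb τ hmin H n) ∧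
    -- `E[N(H)]` is of exact order `n^{(3-τ)k/2 + (τ-1)B_f(H)/2}`
    (HiddenVariable.expCount τ hmin H =Θ[atTop]
      fun n : ℕ => (n : ℝ) ^ HiddenVariable.growthExponent τ H) ∧
    -- so is the contribution of the optimal profile, up to a factor `f(ε)`
    (∃ (f : ℝ → ℝ) (c C : ℝ), 0 < c ∧ 0 < C ∧
      ∀ ε : ℝ, HiddenVariable.Admissible hmin P ε → 0 < f ε ∧
        ∀ᶠ n : ℕ in atTop,
          c * f ε ≤ HiddenVariable.expWindowCount τ hmin H (HiddenVariable.profile P) ε n /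
              (n : ℝ) ^ HiddenVariable.growthExponent τ H ∧
          HiddenVariable.expWindowCount τ hmin H (HiddenVariable.profile P) ε n /
              (n : ℝ) ^ HiddenVariable.growthExponent τ H ≤ C * f ε) ∧
    -- every other profile is negligible by a polynomial factor
    (∀ α : Fin k → ℝ, α ≠ HiddenVariable.profile P → ∃ η : ℝ, 0 < η ∧
      ∀ ε : ℝ, HiddenVariable.Admissible hmin P ε →
        (fun n : ℕ => HiddenVariable.expWindowCount τ hmin H α ε n /
            HiddenVariable.expWindowCount τ hmin H (HiddenVariable.profile P) ε n)
          =O[atTop] fun n : ℕ => (n : ℝ) ^ (-η)) ∧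
    -- the windows of the optimal profile carry the whole leading order as `ε → 0`
    (∀ δ : ℝ, 0 < δ → ∃ ε₀ : ℝ, 0 < ε₀ ∧ ε₀ < 1 ∧ ∀ ε : ℝ, 0 < ε → ε < ε₀ →
      ∀ᶠ n : ℕ in atTop,
        (1 - δ) * HiddenVariable.expCount τ hmin H n ≤
          HiddenVariable.expWindowCount τ hmin H (HiddenVariable.profile P) ε n) :=
  theorem1_general τ hmin hτ hmin_pos k H P hopt huniq
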